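/- Let $M$ be a finite-dimensional smooth Hausdorff manifold, let $1\le r\le\infty$ and let $k\ge 1$. A $C^r$ flow on $M$ generated by a $C^r$ vector field $\xi$ is a $C^r$ map $\phi:D_\phi\to M$, $(t,p)\mapsto\phi_t(p)$, with $D_\phi\subseteq\mathbb R\times M$ open and containing $\{0\}\times M$, such that $\phi_0=\mathrm{id}$ and, for every $p$, the set $\{t : (t,p)\in D_\phi\}$ is an interval on which $t\mapsto\phi_t(p)$ is an integral curve of $\xi$. Let $\phi^{(1)},\dots,\phi^{(k)}$ be $C^r$ flows on $M$ generated by $C^r$ vector fields $\xi_1,\dots,\xi_k$, and let $\Psi:D\to M$ be the family of knight diffeomorphisms of rank $k$ with generators $\xi_1,\dots,\xi_k$, $$\Psi_\lambda=\phi^{(k)}_{\lambda^k/k!}\circ\cdots\circ\phi^{(2)}_{\lambda^2/2}\circ\phi^{(1)}_\lambda ,$$ where $D\subseteq\mathbb R\times M$ is open, contains $\{0\}\times M$, and at each point of $D$ all steps of the composition are defined. Say that $\Psi$ forms a (local) group if for every $\varepsilon>0$ there is $\delta>0$ such that for all $|\sigma|,|\lambda|<\delta$ there are $\tau,\rho$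 with $|\tau|,|\rho|<\varepsilon$, independent of the point of $M$, such that $\Psi_\sigma\circ\Psi_\lambda=\Psi_\tau$ and $\Psi_\lambda^{-1}=\Psi_\rho$ wherever the maps involved are defined. For real numbers $\alpha_1,\dots,\alpha_k$ put $f(\lambda)=\sum_{l=1}^k\alpha_l\lambda^l/l!$. Then: 1. $\Psi$ forms a group if and only if there are a $C^r$ vector field $\xi$ on $M$ and real numbers $\alpha_1,\dots,\alpha_k$ such that $\xi_l=\alpha_l\,\xi$ for all $l$ and $f$ is one-to-one near $\lambda=0$ (so that $\lambda\mapsto f(\lambda)$ is a reparametrisation). 2. If $\xi_1$ is not identically zero, the condition on $f$ is automatic: $\Psi$ forms a group if and only if there are a $C^r$ vector field $\xi$ and real numbers $\alpha_l$ such that $\xi_l=\alpha_l\,\xi$ for all $l$. 3. Whenever $\xi_l=\alpha_l\,\xi$ for all $l$ with $\alpha_1,\dots,\alpha_k$ not all zero (in particular in the situation of 1), the reparametrisation $\bar\lambda=f(\lambda)$ turns $\Psi$ into a flow in canonical form: there is a $C^r$ flow $\phi$ generated by $\xi$ such that, for all $(\lambda,p)\in D$, $\phi_{f(\lambda)}(p)$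 is defined and $\Psi_\lambda(p)=\phi_{f(\lambda)}(p)$. -/

import Mathlib

open scoped Manifold ContDiff Topology

section Knights

variable {E : Type*} [NormedAddCommGroup E] [NormedSpace ℝ E]
  {M : Type*} [TopologicalSpace M] [ChartedSpace E M]

/-- The (possibly only locally defined) map `φ : D → M`, with `D ⊆ ℝ × M` open and containing
`{0} × M`, is the `C^r` flow on `M` generated by the `C^r` vector field `ξ`: it starts at the
identity, and for every `p` the curve `t ↦ φ t p`, defined on the interval `{t | (t, p) ∈ D}`,
is an integral curve of `ξ`. Values of `φ` outside `D` are irrelevant. -/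
structure IsFlow [IsManifold 𝓘(ℝ, E) 1 M] (r : ℕ∞) (ξ : (p : M) → TangentSpace 𝓘(ℝ, E) p)
    (D : Set (ℝ × M)) (φ : ℝ → M → M) : Prop where
  field_contMDiff : ContMDiff 𝓘(ℝ, E) (𝓘(ℝ, E)).tangent r
    (fun p => (⟨p, ξ p⟩ : TangentBundle 𝓘(ℝ, E) M))
  isOpen : IsOpen D
  zero_mem : ∀ p, ((0 : ℝ), p) ∈ D
  interval : ∀ p, {t : ℝ | (t, p) ∈ D}.OrdConnected
  contMDiffOn : ContMDiffOn ((𝓘(ℝ, ℝ)).prod 𝓘(ℝ, E)) 𝓘(ℝ, E) r (fun x : ℝ × M => φ x.1 x.2) D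
  map_zero : ∀ p, φ 0 p = p
  integralCurve : ∀ p, IsMIntegralCurveOn (fun t => φ t p) ξ {t : ℝ | (t, p) ∈ D}

/-- The composition `φ⁽ᵏ⁾_{tᵏ/k!} ∘ ⋯ ∘ φ⁽²⁾_{t²/2} ∘ φ⁽¹⁾_t`. -/
noncomputable def knight (φ : ℕ → ℝ → M → M) : ℕ → ℝ → M → M
  | 0, _, p => p
  | k + 1, t, p => φ (k + 1) (t ^ (k + 1) / (Nat.factorial (k + 1) : ℝ)) (knight φ k t p)

/-- The set of `(t, p)` at which every step of the composition `knight φ k t p` is defined,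
when `φ l` is defined on `Dom l`. -/
def knightDomain (Dom : ℕ → Set (ℝ × M)) (φ : ℕ → ℝ → M → M) (k : ℕ) : Set (ℝ × M) :=
  {x | ∀ l < k, (x.1 ^ (l + 1) / (Nat.factorial (l + 1) : ℝ), knight φ l x.1 x.2) ∈ Dom (l + 1)}

/-- `Ψ : D → M` is a family of knight diffeomorphisms of rank `k` with generators
`ξ 1, …, ξ k`. -/
def IsKnightFamily [IsManifold 𝓘(ℝ, E) 1 M] (r : ℕ∞) (k : ℕ)
    (ξ : ℕ → (p : M) → TangentSpace 𝓘(ℝ, E) p) (D : Set (ℝ × M)) (Ψ : ℝ → M → M) : Prop :=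
  IsOpen D ∧ (∀ p, ((0 : ℝ), p) ∈ D) ∧
    ∃ (Dom : ℕ → Set (ℝ × M)) (φ : ℕ → ℝ → M → M),
      (∀ l, 1 ≤ l → l ≤ k → IsFlow r (ξ l) (Dom l) (φ l)) ∧
      D ⊆ knightDomain Dom φ k ∧
      ∀ t p, (t, p) ∈ D → Ψ t p = knight φ k t p

/-- The one-parameter family `Ψ : D → M` forms a (local) group: for all parameters `s`, `t` close
enough to `0`, the composition `Ψ_s ∘ Ψ_t` is `Ψ_u` and the inverse of `Ψ_t` is `Ψ_v`, for
parameters `u`, `v` that do not depend on the point and that tend to `0` with `s` and `t`.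
Equality of these partially defined maps is equality wherever both sides are defined; when
`D = ℝ × M` it is equality of maps `M → M`. -/
def FormsLocalGroup (D : Set (ℝ × M)) (Ψ : ℝ → M → M) : Prop :=
  ∀ ε > (0 : ℝ), ∃ δ > (0 : ℝ),
    (∀ s t : ℝ, |s| < δ → |t| < δ → ∃ u : ℝ, |u| < ε ∧
      ∀ p, (t, p) ∈ D → (s, Ψ t p) ∈ D → (u, p) ∈ D → Ψ s (Ψ t p) = Ψ u p) ∧
    (∀ t : ℝ, |t| < δ → ∃ v : ℝ, |v| < ε ∧
      (∀ p, (t, p) ∈ D → (v, Ψ t p) ∈ D → Ψ v (Ψ t p) = p) ∧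
      (∀ p, (v, p) ∈ D → (t, Ψ v p) ∈ D → Ψ t (Ψ v p) = p))

end Knights

/-- The function `f(t) = ∑_{l=1}^k α_l t^l / l!`. -/
noncomputable def reparam (k : ℕ) (α : ℕ → ℝ) (t : ℝ) : ℝ :=
  ∑ l ∈ Finset.Icc 1 k, α l * t ^ l / (Nat.factorial l : ℝ)

/-! Suppose first that every generator is `α l • η`. Then step `l` of the composition follows `η`
for time `α l * t ^ l / l!`, and these times add, so `Ψ t` follows `η` for time `f(t)`. A continuous
function injective near `0` is locally onto, so `f(u) = f(s) + f(t)` and `f(v) = -f(t)` have small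
solutions, and uniqueness of integral curves gives the group laws. The relation `FlowsTo` expresses
this without fixing the domain of a flow; the maximal flow of `η` then gives the canonical form.

Conversely, let `X = ξ (j + 1)` be the first nonzero generator, with `X p₀ ≠ 0`, and let `ℓ` be a
functional positive on `X p₀`. In charts `Ψ t q = q + t ^ (j + 1) / (j + 1)! • X q + o(t ^ (j +
1))`, uniformly in the base point. If `j` were odd, small maps could only increase `ℓ` near `p₀`,
which excludes inverses. Hence `j` is even and `t ↦ ℓ (Ψ t p₀)` is strictly increasing near `0`.
Write `Ψ s ∘ Ψ t = Ψ (U s)`. Monotonicity forces `U s → t` as `s → 0`, and comparing increments of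
order `s ^ (j + 1)` at `p` and at `p₀` shows that the velocity of `Ψ t p` is `f t • X`, with a
scalar `f t` that does not depend on `p` (`HasLeadingField.eventually_deriv_eq`; this scalar is not
the polynomial above). Integrating `f` and using ODE uniqueness, `Ψ t p = Φ (F t) p` for the flow
`Φ` of `X`, with one `F` for all `p` (`HasLeadingField.exists_eq_flow`).

The remaining generators are found by induction. If the first `n` are multiples of `X`, the first
`n` steps are `Φ (G t)` for a polynomial `G`, and the terms of order `t ^ (n + 1)` in `Φ (F t) p`
and `Φ (G t) p` differ both by a multiple of `ξ (n + 1) p` and by a multiple of `X p` whose factor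
is common to all `p`. Injectivity of the polynomial follows from the monotonicity at `p₀`. -/

/-! ### Motion along integral curves as a relation between points -/

section Curves

open Set Filter

variable {E : Type*} [NormedAddCommGroup E] [NormedSpace ℝ E]
  {M : Type*} [TopologicalSpace M] [ChartedSpace E M]

/-- The point `q` is reached from `p` in time `t` along an integral curve of `η`. -/
def FlowsTo (η : (p : M) → TangentSpace 𝓘(ℝ, E) p) (t : ℝ) (p q : M) : Prop :=
  ∃ (γ : ℝ → M) (a b : ℝ), IsMIntegralCurveOn γ η (Ioo a b) ∧ (0 : ℝ) ∈ Ioo a b ∧ t ∈ Ioo a b ∧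
    γ 0 = p ∧ γ t = q

/-- Passes from the time slices of flow domains, which may be unbounded, to the bounded open
intervals used by `FlowsTo`. -/
lemma exists_Ioo_subset_of_isOpen_ordConnected {S : Set ℝ} (ho : IsOpen S) (hc : S.OrdConnected)
    {x y : ℝ} (hx : x ∈ S) (hy : y ∈ S) : ∃ a b, Ioo a b ⊆ S ∧ x ∈ Ioo a b ∧ y ∈ Ioo a b := by
  have key : ∀ z ∈ S, ∃ ε > 0, z - ε ∈ S ∧ z + ε ∈ S := by
    intro z hz
    obtain ⟨ε, hε, h⟩ := Metric.isOpen_iff.1 ho z hz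
    refine ⟨ε / 2, by positivity, h ?_, h ?_⟩ <;>
      simp [abs_of_pos hε] <;> linarith
  have hmin : min x y ∈ S := by rcases min_choice x y with h | h <;> rw [h] <;> assumption
  have hmax : max x y ∈ S := by rcases max_choice x y with h | h <;> rw [h] <;> assumption
  obtain ⟨ε, hε, h1, -⟩ := key _ hmin
  obtain ⟨ε', hε', -, h2⟩ := key _ hmax
  have := min_le_left x y
  have := min_le_right x y
  have := le_max_left x y
  have := le_max_right x y
  refine ⟨_, _, Ioo_subset_Icc_self.trans (hc.out h1 h2), ⟨?_, ?_⟩, ⟨?_, ?_⟩⟩ <;> linarith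

variable {η : (p : M) → TangentSpace 𝓘(ℝ, E) p}

lemma IsMIntegralCurveOn.flowsTo {γ : ℝ → M} {a b : ℝ} (h : IsMIntegralCurveOn γ η (Ioo a b))
    {s t : ℝ} (hs : s ∈ Ioo a b) (ht : t ∈ Ioo a b) : FlowsTo η (t - s) (γ s) (γ t) := by
  refine ⟨γ ∘ (· + s), a - s, b - s, (h.comp_add s).mono ?_, ⟨?_, ?_⟩, ⟨?_, ?_⟩, ?_, ?_⟩
  · rintro x ⟨h1, h2⟩
    exact ⟨by linarith, by linarith⟩
  all_goals simp
  exacts [hs.1, hs.2, ht.1, ht.2]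

lemma FlowsTo.of_smul {α t : ℝ} (hα : α ≠ 0) {p q : M} (h : FlowsTo (α • η) t p q) :
    FlowsTo η (α * t) p q := by
  obtain ⟨γ, a, b, hγ, h0, ht, hp, hq⟩ := h
  have h1 := hγ.comp_mul α⁻¹
  rw [smul_smul, inv_mul_cancel₀ hα, one_smul] at h1
  -- Rescaling by a negative `α⁻¹` reverses the interval, hence the two cases.
  have hc : {t | t * α⁻¹ ∈ Ioo a b}.OrdConnected := by
    refine ⟨fun x hx y hy z hz => ?_⟩
    rcases le_total 0 α⁻¹ with h | h
    · exact ⟨hx.1.trans_le (mul_le_mul_of_nonneg_right hz.1 h),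
        (mul_le_mul_of_nonneg_right hz.2 h).trans_lt hy.2⟩
    · exact ⟨hy.1.trans_le (mul_le_mul_of_nonpos_right hz.2 h),
        (mul_le_mul_of_nonpos_right hz.1 h).trans_lt hx.2⟩
  obtain ⟨c, d, hcd, h0', ht'⟩ := exists_Ioo_subset_of_isOpen_ordConnected
    (isOpen_Ioo.preimage (continuous_mul_const α⁻¹)) hc (x := 0) (y := α * t) (by simpa using h0)
    (by simpa [mul_comm α t, hα] using ht)
  refine ⟨_, c, d, h1.mono hcd, h0', ht', by simpa using hp, ?_⟩
  simpa [mul_comm α t, hα] using hq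

variable [T2Space M] [IsManifold 𝓘(ℝ, E) 1 M]

lemma FlowsTo.eq (hη : ContMDiff 𝓘(ℝ, E) (𝓘(ℝ, E)).tangent 1
      (fun p => (⟨p, η p⟩ : TangentBundle 𝓘(ℝ, E) M))) {t : ℝ} {p q q' : M}
    (h : FlowsTo η t p q) (h' : FlowsTo η t p q') : q = q' := by
  obtain ⟨γ, a, b, hγ, h0, ht, hp, hq⟩ := h
  obtain ⟨γ', a', b', hγ', h0', ht', hp', hq'⟩ := h'
  rw [← hq, ← hq']
  exact isMIntegralCurveOn_Ioo_eqOn_of_contMDiff_boundaryless (a := max a a') (b := min b b')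
    (t₀ := 0) ⟨max_lt h0.1 h0'.1, lt_min h0.2 h0'.2⟩ hη
    (hγ.mono (Ioo_subset_Ioo (le_max_left ..) (min_le_left ..)))
    (hγ'.mono (Ioo_subset_Ioo (le_max_right ..) (min_le_right ..))) (hp.trans hp'.symm)
    ⟨max_lt ht.1 ht'.1, lt_min ht.2 ht'.2⟩

/-- The second curve, delayed by `s`, meets the first at time `s`; uniqueness makes the two agree on
their overlap, so they glue to a curve on the union of the two intervals. -/
lemma FlowsTo.trans (hη : ContMDiff 𝓘(ℝ, E) (𝓘(ℝ, E)).tangent 1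
      (fun p => (⟨p, η p⟩ : TangentBundle 𝓘(ℝ, E) M))) {s t : ℝ} {p q w : M}
    (h : FlowsTo η s p q) (h' : FlowsTo η t q w) : FlowsTo η (s + t) p w := by
  obtain ⟨γ, a, b, hγ, h0, hs, hp, hq⟩ := h
  obtain ⟨γ', a', b', hγ', h0', ht', hp', hq'⟩ := h'
  have h1 : IsMIntegralCurveOn (γ' ∘ (· + -s)) η (Ioo (a' + s) (b' + s)) :=
    (hγ'.comp_add (-s)).mono fun x hx => ⟨by linarith [hx.1], by linarith [hx.2]⟩
  have hs' : s ∈ Ioo (a' + s) (b' + s) := ⟨by linarith [h0'.1], by linarith [h0'.2]⟩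
  have ht : s + t ∈ Ioo (a' + s) (b' + s) := ⟨by linarith [ht'.1], by linarith [ht'.2]⟩
  have heq : γ s = (γ' ∘ (· + -s)) s := by simp [hq, hp']
  have h2 := isMIntegralCurveOn_piecewise hη hγ h1 ⟨hs, hs'⟩ heq
  obtain ⟨c, d, hcd, h0c, htc⟩ := exists_Ioo_subset_of_isOpen_ordConnected
    (isOpen_Ioo.union isOpen_Ioo)
    (IsPreconnected.union s hs hs' isPreconnected_Ioo isPreconnected_Ioo).ordConnected
    (Or.inl h0) (Or.inr ht)
  refine ⟨_, c, d, h2.mono hcd, h0c, htc, ?_, ?_⟩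
  · rw [piecewise_eq_of_mem _ _ _ h0, hp]
  · rw [eqOn_piecewise_of_isMIntegralCurveOn_Ioo hη hγ h1 ⟨hs, hs'⟩ heq ht]
    simp [hq']

lemma FlowsTo.eq_of_eq_zero (hη : ContMDiff 𝓘(ℝ, E) (𝓘(ℝ, E)).tangent 1
      (fun p => (⟨p, η p⟩ : TangentBundle 𝓘(ℝ, E) M))) (h0 : ∀ p, η p = 0) {t : ℝ} {p q : M}
    (h : FlowsTo η t p q) : q = p := by
  refine h.eq hη ?_
  exact ⟨fun _ => p, min 0 t - 1, max 0 t + 1, (isMIntegralCurve_const (h0 p)).isMIntegralCurveOn _,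
    ⟨by linarith [min_le_left 0 t], by linarith [le_max_left 0 t]⟩,
    ⟨by linarith [min_le_right 0 t], by linarith [le_max_right 0 t]⟩, rfl, rfl⟩

end Curves

/-! ### Flows as integral curves, and their rescaling -/

section Flows

open Set Filter

variable {E : Type*} [NormedAddCommGroup E] [NormedSpace ℝ E]
  {M : Type*} [TopologicalSpace M] [ChartedSpace E M] [IsManifold 𝓘(ℝ, E) 1 M]
  {r : ℕ∞} {η : (p : M) → TangentSpace 𝓘(ℝ, E) p} {D : Set (ℝ × M)} {φ : ℝ → M → M}

lemma IsFlow.field_contMDiff_one (h : IsFlow r η D φ) (hr : 1 ≤ r) :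
    ContMDiff 𝓘(ℝ, E) (𝓘(ℝ, E)).tangent 1 (fun p => (⟨p, η p⟩ : TangentBundle 𝓘(ℝ, E) M)) :=
  h.field_contMDiff.of_le (by exact_mod_cast hr)

lemma IsFlow.flowsTo (h : IsFlow r η D φ) {t : ℝ} {p : M} (ht : (t, p) ∈ D) :
    FlowsTo η t p (φ t p) := by
  obtain ⟨a, b, hab, h0, ht⟩ := exists_Ioo_subset_of_isOpen_ordConnected
    (h.isOpen.preimage (Continuous.prodMk_left p)) (h.interval p) (h.zero_mem p) ht
  exact ⟨fun t => φ t p, a, b, (h.integralCurve p).mono hab, h0, ht, h.map_zero p, rfl⟩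

lemma IsFlow.flowsTo_zero (h : IsFlow r η D φ) (p : M) : FlowsTo η 0 p p := by
  simpa [h.map_zero] using h.flowsTo (h.zero_mem p)

lemma IsFlow.congr_field {η' : (p : M) → TangentSpace 𝓘(ℝ, E) p} (h : IsFlow r η D φ)
    (hη : ∀ p, η p = η' p) : IsFlow r η' D φ := by
  obtain rfl : η = η' := funext hη
  exact h

lemma IsFlow.of_smul {α : ℝ} (hα : α ≠ 0) (h : IsFlow r (α • η) D φ)
    (hη : ContMDiff 𝓘(ℝ, E) (𝓘(ℝ, E)).tangent r
      (fun p => (⟨p, η p⟩ : TangentBundle 𝓘(ℝ, E) M))) :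
    IsFlow r η {x | (x.1 * α⁻¹, x.2) ∈ D} (fun t p => φ (t * α⁻¹) p) := by
  have hsm : ContMDiff ((𝓘(ℝ, ℝ)).prod 𝓘(ℝ, E)) ((𝓘(ℝ, ℝ)).prod 𝓘(ℝ, E)) r
      (fun x : ℝ × M => (x.1 * α⁻¹, x.2)) := by
    refine ContMDiff.prodMk ?_ contMDiff_snd
    exact ((contDiff_id.mul contDiff_const).contMDiff).comp contMDiff_fst
  refine ⟨hη, h.isOpen.preimage (by fun_prop), fun p => by simpa using h.zero_mem p, ?_,
    h.contMDiffOn.comp hsm.contMDiffOn fun _ hx => hx, fun p => by simpa using h.map_zero p, ?_⟩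
  · refine fun p => ⟨fun x hx y hy z hz => ?_⟩
    rcases le_total 0 α⁻¹ with h0 | h0
    · exact (h.interval p).out hx hy
        ⟨mul_le_mul_of_nonneg_right hz.1 h0, mul_le_mul_of_nonneg_right hz.2 h0⟩
    · exact (h.interval p).out hy hx
        ⟨mul_le_mul_of_nonpos_right hz.2 h0, mul_le_mul_of_nonpos_right hz.1 h0⟩
  · intro p
    have := (h.integralCurve p).comp_mul α⁻¹
    rwa [smul_smul, inv_mul_cancel₀ hα, one_smul] at this

end Flows

/-! ### Maximal flows, and knight compositions of proportional fields -/

section MaximalFlow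

open Set Filter

variable {E : Type*} [NormedAddCommGroup E] [NormedSpace ℝ E]
  {M : Type*} [TopologicalSpace M] [ChartedSpace E M] [IsManifold 𝓘(ℝ, E) 1 M] [T2Space M]
  {r : ℕ∞} {η : (p : M) → TangentSpace 𝓘(ℝ, E) p} {D : Set (ℝ × M)} {φ : ℝ → M → M}

/-- Near each point, the time `t` map along integral curves is a finite composition of local
flow maps with times `t / N`, hence as smooth as the local flow. -/
lemma IsFlow.exists_eventually_flowsTo (h : IsFlow r η D φ) (hr : 1 ≤ r) {t₀ : ℝ} {p₀ q₀ : M}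
    (h₀ : FlowsTo η t₀ p₀ q₀) :
    ∃ ψ : ℝ × M → M, ContMDiffAt ((𝓘(ℝ, ℝ)).prod 𝓘(ℝ, E)) 𝓘(ℝ, E) r ψ (t₀, p₀) ∧
      ∀ᶠ x in 𝓝 (t₀, p₀), FlowsTo η x.1 x.2 (ψ x) := by
  have hη := h.field_contMDiff_one hr
  obtain ⟨γ, a, b, hγ, h0, ht, rfl, rfl⟩ := h₀
  have hsub : uIcc 0 t₀ ⊆ Ioo a b := ordConnected_Ioo.uIcc_subset h0 ht
  have hK : IsCompact (γ '' uIcc 0 t₀) :=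
    isCompact_uIcc.image_of_continuousOn (hγ.continuousOn.mono hsub)
  -- By compactness, all points of the trajectory from `0` to `t₀` share a neighbourhood `U` of time
  -- `0` on which the local flow is defined; `N` is chosen so that `t₀ / N` lies in it.
  obtain ⟨U, V, hU, -, h0U, hV, hUV⟩ := generalized_tube_lemma (isCompact_singleton (x := (0 : ℝ)))
    hK h.isOpen (by rintro ⟨t, p⟩ ⟨rfl, -⟩; exact h.zero_mem p)
  have hlim : Tendsto (fun n : ℕ => t₀ / n) atTop (𝓝 0) := tendsto_const_div_atTop_nhds_zero_nat t₀
  obtain ⟨N, hN, hNpos⟩ := ((hlim.eventually (hU.mem_nhds (h0U rfl))).and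
    (eventually_gt_atTop 0)).exists
  have hN0 : (N : ℝ) ≠ 0 := by positivity
  have hmem : ∀ n : ℕ, n ≤ N → (n : ℝ) * (t₀ / N) ∈ uIcc 0 t₀ := by
    intro n hn
    have h1 : (n : ℝ) / N ≤ 1 := by
      rw [div_le_one (by positivity)]; exact_mod_cast hn
    have h2 : (0 : ℝ) ≤ n / N := by positivity
    have h3 : (n : ℝ) * (t₀ / N) = n / N * t₀ := by ring
    rw [h3, mem_uIcc]
    rcases le_total 0 t₀ with h4 | h4
    · left; exact ⟨by positivity, mul_le_of_le_one_left h4 h1⟩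
    · right; exact ⟨by nlinarith, mul_nonpos_of_nonneg_of_nonpos h2 h4⟩
  have key : ∀ n : ℕ, n ≤ N → ∃ ψ : ℝ × M → M,
      ContMDiffAt ((𝓘(ℝ, ℝ)).prod 𝓘(ℝ, E)) 𝓘(ℝ, E) r ψ (t₀, γ 0) ∧
      ψ (t₀, γ 0) = γ (n * (t₀ / N)) ∧
      ∀ᶠ x in 𝓝 (t₀, γ 0), FlowsTo η (n * (x.1 / N)) x.2 (ψ x) := by
    intro n
    induction n with
    | zero =>
      intro _
      refine ⟨Prod.snd, contMDiffAt_snd, by simp, Eventually.of_forall fun x => ?_⟩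
      simpa using h.flowsTo_zero x.2
    | succ n ih =>
      intro hn
      obtain ⟨ψ, hψ, hψ0, hev⟩ := ih (by omega)
      have hD : (t₀ / N, ψ (t₀, γ 0)) ∈ D := by
        rw [hψ0]
        exact hUV ⟨hN, hV ⟨_, hmem n (by omega), rfl⟩⟩
      have hdiv : ContMDiffAt ((𝓘(ℝ, ℝ)).prod 𝓘(ℝ, E)) 𝓘(ℝ, ℝ) r
          (fun x : ℝ × M => x.1 / (N : ℝ)) (t₀, γ 0) :=
        (((contDiff_id.div_const (N : ℝ)).contMDiff).comp contMDiff_fst).contMDiffAt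
      have hpair := hdiv.prodMk hψ
      refine ⟨fun x => φ (x.1 / N) (ψ x), ?_, ?_, ?_⟩
      · exact ContMDiffAt.comp (t₀, γ 0) (g := fun x : ℝ × M => φ x.1 x.2)
          (h.contMDiffOn.contMDiffAt (h.isOpen.mem_nhds hD)) hpair
      -- Uniqueness keeps the centre on the trajectory `γ`, where the next local step is known to be
      -- defined.
      · have h1 := h.flowsTo hD
        have h2 := hγ.flowsTo (hsub (hmem n (by omega))) (hsub (hmem (n + 1) hn))
        rw [hψ0] at h1
        have h3 : ((n + 1 : ℕ) : ℝ) * (t₀ / N) - n * (t₀ / N) = t₀ / N := by push_cast; ring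
        rw [h3] at h2
        simpa only [hψ0] using h1.eq hη h2
      · filter_upwards [hev, hpair.continuousAt.preimage_mem_nhds (h.isOpen.mem_nhds hD)]
          with x hx hxD
        have := hx.trans hη (h.flowsTo hxD)
        convert this using 1
        push_cast; ring
  obtain ⟨ψ, hψ, -, hev⟩ := key N le_rfl
  refine ⟨ψ, hψ, hev.mono fun x hx => ?_⟩
  rwa [mul_div_cancel₀ _ hN0] at hx

/-- A flow extends to a maximal flow of the same field. -/
theorem IsFlow.exists_maximal (h : IsFlow r η D φ) (hr : 1 ≤ r) :
    ∃ (D' : Set (ℝ × M)) (φ' : ℝ → M → M), IsFlow r η D' φ' ∧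
      ∀ t p q, FlowsTo η t p q → (t, p) ∈ D' ∧ φ' t p = q := by
  classical
  have hη := h.field_contMDiff_one hr
  let D' : Set (ℝ × M) := {x | ∃ q, FlowsTo η x.1 x.2 q}
  let φ' : ℝ → M → M := fun t p => if h : ∃ q, FlowsTo η t p q then h.choose else p
  have hφ' : ∀ {t p q}, FlowsTo η t p q → φ' t p = q := by
    intro t p q hq
    have hex : ∃ q, FlowsTo η t p q := ⟨q, hq⟩
    have : φ' t p = hex.choose := dif_pos hex
    rw [this]
    exact hex.choose_spec.eq hη hq
  have hcurve : ∀ t p, (t, p) ∈ D' → ∃ a b, Ioo a b ⊆ {s | (s, p) ∈ D'} ∧ 0 ∈ Ioo a b ∧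
      t ∈ Ioo a b ∧ IsMIntegralCurveOn (fun s => φ' s p) η (Ioo a b) := by
    rintro t p ⟨q, γ, a, b, hγ, h0, ht, rfl, hq⟩
    have hfl : ∀ s ∈ Ioo a b, FlowsTo η s (γ 0) (γ s) := fun s hs => by
      simpa using hγ.flowsTo h0 hs
    refine ⟨a, b, fun s hs => ⟨_, hfl s hs⟩, h0, ht, fun s hs => ?_⟩
    have := (hγ s hs).congr_of_eventuallyEq (f₁ := fun s => φ' s (γ 0))
      (eventuallyEq_nhdsWithin_of_eqOn fun s hs => hφ' (hfl s hs)) (hφ' (hfl s hs))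
    -- The derivative has to live in the tangent space at `φ' s (γ 0)` rather than at `γ s`;
    -- generalising the point permits the substitution.
    have aux : ∀ y, y = γ s → HasMFDerivWithinAt 𝓘(ℝ, ℝ) 𝓘(ℝ, E) (fun s => φ' s (γ 0)) (Ioo a b) s
        ((1 : ℝ →L[ℝ] ℝ).smulRight (η y : E)) := by
      rintro _ rfl
      exact this
    exact aux _ (hφ' (hfl s hs))
  refine ⟨D', φ', ⟨h.field_contMDiff, ?_, fun p => ⟨p, h.flowsTo_zero p⟩, ?_, ?_,
    fun p => hφ' (h.flowsTo_zero p), ?_⟩, fun t p q hq => ⟨⟨q, hq⟩, hφ' hq⟩⟩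
  · rw [isOpen_iff_mem_nhds]
    rintro ⟨t, p⟩ ⟨q, hq⟩
    obtain ⟨ψ, -, hev⟩ := h.exists_eventually_flowsTo hr hq
    exact hev.mono fun x hx => ⟨_, hx⟩
  · intro p
    rw [ordConnected_iff_uIcc_subset_left (x := 0)
      (show (0, p) ∈ D' from ⟨p, h.flowsTo_zero p⟩)]
    intro t ht
    obtain ⟨a, b, hsub, h0, ht, -⟩ := hcurve t p ht
    exact (ordConnected_Ioo.uIcc_subset h0 ht).trans hsub
  · rintro ⟨t, p⟩ ⟨q, hq⟩
    obtain ⟨ψ, hψ, hev⟩ := h.exists_eventually_flowsTo hr hq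
    exact (hψ.congr_of_eventuallyEq (hev.mono fun x hx => hφ' hx)).contMDiffWithinAt
  · intro p
    refine IsMIntegralCurveAt.isMIntegralCurveOn fun t ht => ?_
    obtain ⟨a, b, -, -, ht, hc⟩ := hcurve t p ht
    exact hc.isMIntegralCurveAt (Ioo_mem_nhds ht.1 ht.2)

lemma reparam_succ (n : ℕ) (α : ℕ → ℝ) (t : ℝ) : reparam (n + 1) α t =
    reparam n α t + α (n + 1) * (t ^ (n + 1) / (Nat.factorial (n + 1) : ℝ)) := by
  rw [reparam, Finset.sum_Icc_succ_top (by omega), reparam, mul_div_assoc]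

/-- Each step follows `η` for a multiple of its own time, and consecutive times add by
`FlowsTo.trans`. -/
lemma flowsTo_knight {k : ℕ} {ξ : ℕ → (p : M) → TangentSpace 𝓘(ℝ, E) p} {α : ℕ → ℝ}
    {Dom : ℕ → Set (ℝ × M)} {φ : ℕ → ℝ → M → M}
    (hη : ContMDiff 𝓘(ℝ, E) (𝓘(ℝ, E)).tangent 1
      (fun p => (⟨p, η p⟩ : TangentBundle 𝓘(ℝ, E) M))) (h0 : ∀ p, FlowsTo η 0 p p) (hr : 1 ≤ r)
    (hφ : ∀ l, 1 ≤ l → l ≤ k → IsFlow r (ξ l) (Dom l) (φ l))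
    (hξ : ∀ l, 1 ≤ l → l ≤ k → ∀ p, ξ l p = α l • η p) {t : ℝ} {p : M}
    (h : (t, p) ∈ knightDomain Dom φ k) : FlowsTo η (reparam k α t) p (knight φ k t p) := by
  induction k with
  | zero => simpa [reparam, knight] using h0 p
  | succ k ih =>
    rw [reparam_succ]
    refine (ih (fun l h1 h2 => hφ l h1 (by omega)) (fun l h1 h2 => hξ l h1 (by omega))
      fun l hl => h l (by omega)).trans hη ?_
    have hf := hφ (k + 1) (by omega) le_rfl
    have h1 := hf.flowsTo (h k (by omega))
    -- For a zero coefficient time cannot be rescaled, but then the step fixes every point.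
    by_cases hα : α (k + 1) = 0
    · have h2 : ∀ p, ξ (k + 1) p = 0 := fun p => by
        rw [hξ _ (by omega) le_rfl, hα]; exact zero_smul ℝ _
      have := h1.eq_of_eq_zero (hf.field_contMDiff_one hr) h2
      rw [hα, zero_mul, knight, this]
      exact h0 _
    · have h3 : ξ (k + 1) = α (k + 1) • η := funext fun p => hξ _ (by omega) le_rfl p
      rw [h3] at h1
      exact h1.of_smul hα

end MaximalFlow

/-! ### The polynomial `f` near zero -/

section Reparam

open Set Filter

variable {k : ℕ} {α : ℕ → ℝ}

lemma reparam_zero_right (k : ℕ) (α : ℕ → ℝ) : reparam k α 0 = 0 := by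
  refine Finset.sum_eq_zero fun l hl => ?_
  have : l ≠ 0 := by have := (Finset.mem_Icc.1 hl).1; omega
  simp [this]

lemma continuous_reparam (k : ℕ) (α : ℕ → ℝ) : Continuous (reparam k α) := by
  unfold reparam; fun_prop

lemma hasStrictDerivAt_reparam (hk : 1 ≤ k) (α : ℕ → ℝ) :
    HasStrictDerivAt (reparam k α) (α 1) 0 := by
  induction k, hk using Nat.le_induction with
  | base =>
    have : reparam 1 α = fun t => α 1 * t := by ext; simp [reparam]
    rw [this]
    simpa using (hasStrictDerivAt_id (0 : ℝ)).const_mul (α 1)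
  | succ n hn ih =>
    have h1 : reparam (n + 1) α = fun t =>
        reparam n α t + α (n + 1) * (t ^ (n + 1) / (Nat.factorial (n + 1) : ℝ)) :=
      funext fun t => reparam_succ n α t
    rw [h1]
    have h2 := ih.add (((hasStrictDerivAt_pow (n + 1) (0 : ℝ)).div_const
      (Nat.factorial (n + 1) : ℝ)).const_mul (α (n + 1)))
    convert! h2 using 1
    simp [show n ≠ 0 by omega]

/-- The derivative of `f` at `0` is `α 1`, so a strict-derivative local inverse exists. -/
lemma exists_injOn_reparam (hk : 1 ≤ k) (h : α 1 ≠ 0) :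
    ∃ U ∈ 𝓝 (0 : ℝ), InjOn (reparam k α) U := by
  have hs := (hasStrictDerivAt_reparam hk α).hasStrictFDerivAt_equiv h
  refine ⟨_, hs.eventually_left_inverse, fun x hx y hy hxy => ?_⟩
  rw [← (show _ = x from hx), ← (show _ = y from hy), hxy]

/-- A continuous function which is injective near a point is locally surjective there. -/
lemma exists_ball_subset_image_of_injOn {f : ℝ → ℝ} (hf : Continuous f) (hf0 : f 0 = 0)
    {U : Set ℝ} (hU : U ∈ 𝓝 (0 : ℝ)) (hinj : InjOn f U) {ε : ℝ} (hε : 0 < ε) :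
    ∃ c > 0, ∀ y, |y| < c → ∃ x, |x| < ε ∧ f x = y := by
  obtain ⟨ρ, hρ, hball⟩ := Metric.mem_nhds_iff.1 hU
  set d := min (ε / 2) (ρ / 2) with hd
  have hd0 : 0 < d := by positivity
  have hdε : d < ε := (min_le_left _ _).trans_lt (by linarith)
  have hdρ : d < ρ := (min_le_right _ _).trans_lt (by linarith)
  have hsub : Icc (-d) d ⊆ U := fun x hx => hball (by
    rw [Metric.mem_ball, Real.dist_eq, sub_zero]
    exact (abs_le.2 hx).trans_lt hdρ)
  have hm : -d ∈ Icc (-d) d := ⟨le_rfl, by linarith⟩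
  have hp : d ∈ Icc (-d) d := ⟨by linarith, le_rfl⟩
  have hz : (0 : ℝ) ∈ Icc (-d) d := ⟨by linarith, hd0.le⟩
  rcases hf.continuousOn.strictMonoOn_of_injOn_Icc' (by linarith) (hinj.mono hsub) with h | h
  · have h1 := h hm hz (by linarith)
    have h2 := h hz hp hd0
    rw [hf0] at h1 h2
    refine ⟨min (-f (-d)) (f d), lt_min (by linarith) h2, fun y hy => ?_⟩
    have h3 := abs_lt.1 hy
    obtain ⟨x, hx, rfl⟩ := intermediate_value_Icc (by linarith : -d ≤ d) hf.continuousOn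
      (show y ∈ Icc (f (-d)) (f d) from ⟨by linarith [min_le_left (-f (-d)) (f d)],
        by linarith [min_le_right (-f (-d)) (f d)]⟩)
    exact ⟨x, (abs_le.2 hx).trans_lt hdε, rfl⟩
  · have h1 := h hm hz (by linarith)
    have h2 := h hz hp hd0
    rw [hf0] at h1 h2
    refine ⟨min (f (-d)) (-f d), lt_min h1 (by linarith), fun y hy => ?_⟩
    have h3 := abs_lt.1 hy
    obtain ⟨x, hx, rfl⟩ := intermediate_value_Icc' (by linarith : -d ≤ d) hf.continuousOn
      (show y ∈ Icc (f d) (f (-d)) from ⟨by linarith [min_le_right (f (-d)) (-f d)],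
        by linarith [min_le_left (f (-d)) (-f d)]⟩)
    exact ⟨x, (abs_le.2 hx).trans_lt hdε, rfl⟩

end Reparam

/-! ### Proportional generators: canonical form and group property -/

section Proportional

open Set Filter

variable {E : Type*} [NormedAddCommGroup E] [NormedSpace ℝ E]
  {M : Type*} [TopologicalSpace M] [ChartedSpace E M] [IsManifold 𝓘(ℝ, E) ∞ M]
  {r : ℕ∞} {η : (p : M) → TangentSpace 𝓘(ℝ, E) p} {k : ℕ} {α : ℕ → ℝ}
  {ξ : ℕ → (p : M) → TangentSpace 𝓘(ℝ, E) p} {D : Set (ℝ × M)} {Ψ : ℝ → M → M}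

/-- Recovers the smoothness of the common field, which the canonical form does not assume, from one
generator with nonzero coefficient. -/
lemma ContMDiff.of_const_smul_section {c : ℝ} (hc : c ≠ 0)
    (h : ContMDiff 𝓘(ℝ, E) (𝓘(ℝ, E)).tangent r
      (fun p => (⟨p, (c • η) p⟩ : TangentBundle 𝓘(ℝ, E) M))) :
    ContMDiff 𝓘(ℝ, E) (𝓘(ℝ, E)).tangent r
      (fun p => (⟨p, η p⟩ : TangentBundle 𝓘(ℝ, E) M)) := by
  have : IsManifold 𝓘(ℝ, E) (r + 1) M := IsManifold.of_le (n := ∞) (by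
    exact_mod_cast (le_top : (r + 1 : ℕ∞) ≤ ⊤))
  have : ContMDiffVectorBundle r E (TangentSpace 𝓘(ℝ, E) : M → Type _) 𝓘(ℝ, E) :=
    TangentBundle.contMDiffVectorBundle
  have h1 := ContMDiff.const_smul_section (a := c⁻¹) h
  rwa [smul_smul, inv_mul_cancel₀ hc, one_smul] at h1

variable [T2Space M]

/-- When all generators are multiples of a single field, a knight family moves points along the
flow of that field. -/
lemma IsKnightFamily.exists_maximal_flow (hr : 1 ≤ r) (hΨ : IsKnightFamily r k ξ D Ψ)
    (hξ : ∀ l, 1 ≤ l → l ≤ k → ∀ p, ξ l p = α l • η p) (hα : ∃ l, 1 ≤ l ∧ l ≤ k ∧ α l ≠ 0) :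
    ∃ (D' : Set (ℝ × M)) (φ : ℝ → M → M), IsFlow r η D' φ ∧
      (∀ t p q, FlowsTo η t p q → (t, p) ∈ D' ∧ φ t p = q) ∧
      ∀ t p, (t, p) ∈ D → FlowsTo η (reparam k α t) p (Ψ t p) := by
  obtain ⟨-, -, Dom, φ, hφ, hD, hΨeq⟩ := hΨ
  obtain ⟨l, hl1, hlk, hαl⟩ := hα
  have hfl := (hφ l hl1 hlk).congr_field (η' := α l • η) (hξ l hl1 hlk)
  have hloc := hfl.of_smul hαl (hfl.field_contMDiff.of_const_smul_section hαl)
  obtain ⟨D', φ', hφ', hmax⟩ := hloc.exists_maximal hr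
  refine ⟨D', φ', hφ', hmax, fun t p htp => ?_⟩
  rw [hΨeq t p htp]
  exact flowsTo_knight (hφ'.field_contMDiff_one hr) hφ'.flowsTo_zero hr hφ hξ (hD htp)

/-- Times along `η` add, so composition and inversion reduce to solving `f(u) = f(t) + f(s)` and
`f(v) = -f(t)` near `0`. -/
lemma IsKnightFamily.formsLocalGroup (hr : 1 ≤ r) (hΨ : IsKnightFamily r k ξ D Ψ)
    (hξ : ∀ l, 1 ≤ l → l ≤ k → ∀ p, ξ l p = α l • η p)
    (hinj : ∃ U ∈ 𝓝 (0 : ℝ), InjOn (reparam k α) U) : FormsLocalGroup D Ψ := by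
  obtain ⟨U, hU, hinj⟩ := hinj
  -- If all coefficients vanished, `f` would be constant and not injective near `0`.
  have hα : ∃ l, 1 ≤ l ∧ l ≤ k ∧ α l ≠ 0 := by
    by_contra! h
    have h0 : ∀ t, reparam k α t = 0 := fun t => Finset.sum_eq_zero fun l hl => by
      rw [h l (Finset.mem_Icc.1 hl).1 (Finset.mem_Icc.1 hl).2]; simp
    obtain ⟨ρ, hρ, hball⟩ := Metric.mem_nhds_iff.1 hU
    have h1 : ρ / 2 = 0 := hinj (hball (by
      rw [Metric.mem_ball, Real.dist_eq, sub_zero, abs_of_pos (by positivity)]; linarith))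
      (mem_of_mem_nhds hU) (by rw [h0, h0])
    linarith
  obtain ⟨D', φ, hφ, -, hfl⟩ := hΨ.exists_maximal_flow hr hξ hα
  have hη := hφ.field_contMDiff_one hr
  intro ε hε
  obtain ⟨c, hc, hsurj⟩ := exists_ball_subset_image_of_injOn (continuous_reparam k α)
    (reparam_zero_right k α) hU hinj hε
  obtain ⟨δ, hδ, hf⟩ := Metric.continuousAt_iff.1 ((continuous_reparam k α).continuousAt (x := 0))
    (c / 2) (by positivity)
  simp only [Real.dist_eq, reparam_zero_right, sub_zero] at hf
  refine ⟨δ, hδ, fun s t hs ht => ?_, fun t ht => ?_⟩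
  · obtain ⟨u, hu, hfu⟩ := hsurj (reparam k α t + reparam k α s)
      ((abs_add_le _ _).trans_lt (by linarith [hf hs, hf ht]))
    refine ⟨u, hu, fun p h1 h2 h3 => ?_⟩
    have h4 := (hfl t p h1).trans hη (hfl s _ h2)
    rw [← hfu] at h4
    exact h4.eq hη (hfl u p h3)
  · obtain ⟨v, hv, hfv⟩ := hsurj (-reparam k α t) (by rw [abs_neg]; linarith [hf ht])
    refine ⟨v, hv, fun p h1 h2 => ?_, fun p h1 h2 => ?_⟩
    · have h4 := (hfl t p h1).trans hη (hfl v _ h2)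
      rw [hfv, add_neg_cancel] at h4
      exact h4.eq hη (hφ.flowsTo_zero p)
    · have h4 := (hfl v p h1).trans hη (hfl t _ h2)
      rw [hfv, neg_add_cancel] at h4
      exact h4.eq hη (hφ.flowsTo_zero p)

end Proportional

/-! ### First-order expansion of a flow in a chart -/

section Chart

open Set Filter Asymptotics

variable {E : Type*} [NormedAddCommGroup E] [NormedSpace ℝ E]
  {M : Type*} [TopologicalSpace M] [ChartedSpace E M] [IsManifold 𝓘(ℝ, E) 1 M]
  {v : (p : M) → TangentSpace 𝓘(ℝ, E) p}

/-- The coordinates of the vector `v q` in the chart at `p`. -/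
noncomputable def chartVec (v : (p : M) → TangentSpace 𝓘(ℝ, E) p) (p q : M) : E :=
  tangentCoordChange 𝓘(ℝ, E) q p q (v q)

lemma chartVec_self (p : M) : chartVec v p p = v p :=
  tangentCoordChange_self (mem_extChartAt_source p)

lemma hasDerivAt_extChartAt_comp {γ : ℝ → M} {t : ℝ} {p : M}
    (hγ : HasMFDerivAt 𝓘(ℝ, ℝ) 𝓘(ℝ, E) γ t ((1 : ℝ →L[ℝ] ℝ).smulRight (v (γ t))))
    (hsrc : γ t ∈ (extChartAt 𝓘(ℝ, E) p).source) :
    HasDerivAt (fun s => extChartAt 𝓘(ℝ, E) p (γ s)) (chartVec v p (γ t)) t := by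
  rw [extChartAt_source] at hsrc
  have h1 := HasMFDerivAt.comp t (hasMFDerivAt_extChartAt (I := 𝓘(ℝ, E)) hsrc) hγ
  rw [mfderiv_chartAt_eq_tangentCoordChange hsrc] at h1
  let L : E →L[ℝ] E := tangentCoordChange 𝓘(ℝ, E) (γ t) p (γ t)
  let w : E := v (γ t)
  have h2 : HasFDerivAt (fun s => extChartAt 𝓘(ℝ, E) p (γ s))
      (L.comp ((1 : ℝ →L[ℝ] ℝ).smulRight w)) t := h1.hasFDerivAt
  have h3 : L.comp ((1 : ℝ →L[ℝ] ℝ).smulRight w) 1 = L w := by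
    rw [ContinuousLinearMap.comp_apply, ContinuousLinearMap.smulRight_apply,
      one_apply_eq_self, one_smul]
  exact h2.hasDerivAt.congr_deriv h3

lemma contDiffAt_chartVec (hv : ContMDiff 𝓘(ℝ, E) (𝓘(ℝ, E)).tangent 1
      (fun p => (⟨p, v p⟩ : TangentBundle 𝓘(ℝ, E) M))) (p : M) :
    ContDiffAt ℝ 1 (fun y => chartVec v p ((extChartAt 𝓘(ℝ, E) p).symm y))
      (extChartAt 𝓘(ℝ, E) p p) := by
  have h := contMDiffAt_iff.1 (hv p)
  exact (h.2.contDiffAt (by simp)).snd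

variable {r : ℕ∞} {η : (p : M) → TangentSpace 𝓘(ℝ, E) p} {D : Set (ℝ × M)} {φ : ℝ → M → M}

lemma IsFlow.continuousAt (h : IsFlow r η D φ) {x : ℝ × M} (hx : x ∈ D) :
    ContinuousAt (fun x : ℝ × M => φ x.1 x.2) x :=
  h.contMDiffOn.continuousOn.continuousAt (h.isOpen.mem_nhds hx)

lemma IsFlow.contDiffAt_chart (h : IsFlow r η D φ) (hr : 1 ≤ r) {p q : M}
    (hq : q ∈ (extChartAt 𝓘(ℝ, E) p).source) :
    ContDiffAt ℝ 1 (fun x : ℝ × E =>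
      extChartAt 𝓘(ℝ, E) p (φ x.1 ((extChartAt 𝓘(ℝ, E) p).symm x.2)))
      (0, extChartAt 𝓘(ℝ, E) p q) := by
  set e := extChartAt 𝓘(ℝ, E) p with he
  have heq : e.symm (e q) = q := e.left_inv hq
  have h1 : ContMDiffAt 𝓘(ℝ, E) 𝓘(ℝ, E) 1 e.symm (e q) :=
    (contMDiffOn_extChartAt_symm p).contMDiffAt
      ((isOpen_extChartAt_target p).mem_nhds (e.map_source hq))
  have h2 : ContMDiffAt ((𝓘(ℝ, ℝ)).prod 𝓘(ℝ, E)) 𝓘(ℝ, E) 1 (fun x : ℝ × M => φ x.1 x.2) (0, q) :=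
    (h.contMDiffOn.contMDiffAt (h.isOpen.mem_nhds (h.zero_mem q))).of_le (by exact_mod_cast hr)
  have h3 : ContMDiffAt 𝓘(ℝ, E) 𝓘(ℝ, E) 1 e q := contMDiffAt_extChartAt' (by
    rwa [he, extChartAt_source] at hq)
  have h4 : ContMDiffAt ((𝓘(ℝ, ℝ)).prod 𝓘(ℝ, E)) ((𝓘(ℝ, ℝ)).prod 𝓘(ℝ, E)) 1
      (fun x : ℝ × E => (x.1, e.symm x.2)) (0, e q) :=
    contMDiffAt_fst.prodMk (ContMDiffAt.comp (0, e q) (g := e.symm) h1 contMDiffAt_snd)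
  have h5 : ContMDiffAt ((𝓘(ℝ, ℝ)).prod 𝓘(ℝ, E)) 𝓘(ℝ, E) 1
      (fun x : ℝ × E => φ x.1 (e.symm x.2)) (0, e q) :=
    ContMDiffAt.comp (0, e q) (g := fun x : ℝ × M => φ x.1 x.2) (by simpa [heq] using h2) h4
  have h6 : ContMDiffAt ((𝓘(ℝ, ℝ)).prod 𝓘(ℝ, E)) 𝓘(ℝ, E) 1
      (fun x : ℝ × E => e (φ x.1 (e.symm x.2))) (0, e q) :=
    ContMDiffAt.comp (0, e q) (g := e) (by simpa [heq, h.map_zero] using h3) h5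
  rw [← modelWithCornersSelf_prod, chartedSpaceSelf_prod] at h6
  exact h6.contDiffAt

lemma IsFlow.hasMFDerivAt (h : IsFlow r η D φ) {t : ℝ} {p : M} (ht : (t, p) ∈ D) :
    HasMFDerivAt 𝓘(ℝ, ℝ) 𝓘(ℝ, E) (fun s => φ s p) t
      ((1 : ℝ →L[ℝ] ℝ).smulRight (η (φ t p))) :=
  (h.integralCurve p t ht).hasMFDerivAt
    ((h.isOpen.preimage (Continuous.prodMk_left p)).mem_nhds ht)

/-- The time direction contributes the field, and the space direction the identity because the flow
at time `0` is the identity. -/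
lemma IsFlow.hasStrictFDerivAt_chart (h : IsFlow r η D φ) (hr : 1 ≤ r) {p q : M}
    (hq : q ∈ (extChartAt 𝓘(ℝ, E) p).source) :
    HasStrictFDerivAt (fun x : ℝ × E =>
      extChartAt 𝓘(ℝ, E) p (φ x.1 ((extChartAt 𝓘(ℝ, E) p).symm x.2)))
      ((ContinuousLinearMap.fst ℝ ℝ E).smulRight (chartVec η p q) +
        ContinuousLinearMap.snd ℝ ℝ E)
      (0, extChartAt 𝓘(ℝ, E) p q) := by
  set e := extChartAt 𝓘(ℝ, E) p with he
  have heq : e.symm (e q) = q := e.left_inv hq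
  have hs := (h.contDiffAt_chart hr hq).hasStrictFDerivAt one_ne_zero
  rw [← he] at hs
  set L := fderiv ℝ (fun x : ℝ × E => e (φ x.1 (e.symm x.2))) (0, e q) with hL
  have h1 : L (1, 0) = chartVec η p q := by
    have h2 : HasDerivAt (fun t : ℝ => e (φ t (e.symm (e q)))) (L (1, 0)) 0 :=
      HasFDerivAt.comp_hasDerivAt (0 : ℝ) (f := fun t : ℝ => (t, e q)) hs.hasFDerivAt
        ((hasDerivAt_id (0 : ℝ)).prodMk (hasDerivAt_const (0 : ℝ) (e q)))
    rw [heq] at h2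
    have h3 := hasDerivAt_extChartAt_comp (p := p) (h.hasMFDerivAt (h.zero_mem q))
      (by rw [h.map_zero]; exact hq)
    rw [h.map_zero] at h3
    exact h2.unique h3
  have h4 : ∀ b, L (0, b) = b := by
    intro b
    have h5 : HasFDerivAt (fun y : E => e (φ 0 (e.symm y)))
        (L.comp (ContinuousLinearMap.inr ℝ ℝ E)) (e q) :=
      HasFDerivAt.comp (e q) (g := fun x : ℝ × E => e (φ x.1 (e.symm x.2)))
        (f := fun y : E => ((0 : ℝ), y)) hs.hasFDerivAt
        ((hasFDerivAt_const (0 : ℝ) (e q)).prodMk (hasFDerivAt_id (e q)))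
    have h6 : HasFDerivAt (fun y : E => e (φ 0 (e.symm y))) (ContinuousLinearMap.id ℝ E) (e q) := by
      refine (hasFDerivAt_id (e q)).congr_of_eventuallyEq ?_
      filter_upwards [(isOpen_extChartAt_target p).mem_nhds (e.map_source hq)] with y hy
      simp [h.map_zero, e.right_inv hy]
    have h7 := congrArg (fun A : E →L[ℝ] E => A b) (h5.unique h6)
    simpa using h7
  have hLeq : (ContinuousLinearMap.fst ℝ ℝ E).smulRight (chartVec η p q) +
      ContinuousLinearMap.snd ℝ ℝ E = L := by
    ext
    · simp [h1]
    · simp [h4]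
  rw [hLeq]
  exact hs

/-- Strict differentiability, applied to the pair `(t, e x)`, `(0, e x)`, makes the error `o(t)`
uniform in the base point `x` near `q`. Compositions need this, since their base points move with
`t`. -/
lemma IsFlow.isLittleO_chart (h : IsFlow r η D φ) (hr : 1 ≤ r) {p q : M}
    (hq : q ∈ (extChartAt 𝓘(ℝ, E) p).source) :
    (fun x : ℝ × M => extChartAt 𝓘(ℝ, E) p (φ x.1 x.2) - extChartAt 𝓘(ℝ, E) p x.2 -
      x.1 • chartVec η p q) =o[𝓝 (0, q)] fun x => x.1 := by
  set e := extChartAt 𝓘(ℝ, E) p with he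
  have hs := (h.hasStrictFDerivAt_chart hr hq).isLittleO
  rw [← he] at hs
  have hlim : Tendsto (fun x : ℝ × M => ((x.1, e x.2), ((0 : ℝ), e x.2))) (𝓝 (0, q))
      (𝓝 ((0, e q), (0, e q))) := by
    have h1 : ContinuousAt (fun x : ℝ × M => e x.2) (0, q) :=
      ContinuousAt.comp (g := e) (continuousAt_extChartAt' hq) continuousAt_snd
    exact (continuousAt_fst.prodMk h1).prodMk (continuousAt_const.prodMk h1)
  have h2 := hs.comp_tendsto hlim
  have hsrc : ∀ᶠ x : ℝ × M in 𝓝 (0, q), x.2 ∈ e.source :=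
    continuousAt_snd.eventually ((isOpen_extChartAt_source p).mem_nhds hq)
  refine (h2.trans_isBigO (isBigO_of_le _ fun x => ?_)).congr' ?_ EventuallyEq.rfl
  · simp
  · filter_upwards [hsrc] with x hx
    simp only [Function.comp, h.map_zero, e.left_inv hx]
    simp

end Chart

/-! ### Expansion of knight compositions and of their velocities -/

section KnightExpansion

open Set Filter Asymptotics

variable {E : Type*} [NormedAddCommGroup E] [NormedSpace ℝ E]
  {M : Type*} [TopologicalSpace M] [ChartedSpace E M] [IsManifold 𝓘(ℝ, E) 1 M]
  {r : ℕ∞} {k : ℕ} {ξ : ℕ → (p : M) → TangentSpace 𝓘(ℝ, E) p}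
  {Dom : ℕ → Set (ℝ × M)} {φ : ℕ → ℝ → M → M}

lemma knight_zero_left (hφ : ∀ l, 1 ≤ l → l ≤ k → IsFlow r (ξ l) (Dom l) (φ l)) {n : ℕ}
    (hn : n ≤ k) (p : M) : knight φ n 0 p = p := by
  induction n with
  | zero => rfl
  | succ n ih =>
    rw [knight, ih (by omega)]
    simpa using (hφ (n + 1) (by omega) hn).map_zero p

lemma contMDiffAt_knight (hφ : ∀ l, 1 ≤ l → l ≤ k → IsFlow r (ξ l) (Dom l) (φ l)) {n : ℕ}
    (hn : n ≤ k) (q : M) : ContMDiffAt ((𝓘(ℝ, ℝ)).prod 𝓘(ℝ, E)) 𝓘(ℝ, E) r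
      (fun x : ℝ × M => knight φ n x.1 x.2) (0, q) := by
  induction n with
  | zero => exact contMDiffAt_snd
  | succ n ih =>
    have hf := hφ (n + 1) (by omega) hn
    have hτ : ContMDiffAt ((𝓘(ℝ, ℝ)).prod 𝓘(ℝ, E)) 𝓘(ℝ, ℝ) r
        (fun x : ℝ × M => x.1 ^ (n + 1) / (Nat.factorial (n + 1) : ℝ)) (0, q) := by
      have h1 : ContDiff ℝ r fun t : ℝ => t ^ (n + 1) / (Nat.factorial (n + 1) : ℝ) := by fun_prop
      exact (h1.contMDiff.comp contMDiff_fst).contMDiffAt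
    refine ContMDiffAt.comp (0, q) (g := fun x : ℝ × M => φ (n + 1) x.1 x.2)
      ?_ (hτ.prodMk (ih (by omega)))
    refine hf.contMDiffOn.contMDiffAt (hf.isOpen.mem_nhds ?_)
    simpa [knight_zero_left hφ (show n ≤ k by omega)] using hf.zero_mem q

lemma tendsto_knight (hφ : ∀ l, 1 ≤ l → l ≤ k → IsFlow r (ξ l) (Dom l) (φ l)) {n : ℕ}
    (hn : n ≤ k) (q : M) :
    Tendsto (fun x : ℝ × M => knight φ n x.1 x.2) (𝓝 (0, q)) (𝓝 q) := by
  have h := (contMDiffAt_knight hφ hn q).continuousAt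
  simpa [ContinuousAt, knight_zero_left hφ hn] using h

lemma tendsto_knight_step (hφ : ∀ l, 1 ≤ l → l ≤ k → IsFlow r (ξ l) (Dom l) (φ l)) {n : ℕ}
    (hn : n ≤ k) (q : M) :
    Tendsto (fun x : ℝ × M =>
        (x.1 ^ (n + 1) / (Nat.factorial (n + 1) : ℝ), knight φ n x.1 x.2))
      (𝓝 (0, q)) (𝓝 (0, q)) := by
  refine Tendsto.prodMk_nhds ?_ (tendsto_knight hφ hn q)
  have h : ContinuousAt (fun x : ℝ × M => x.1 ^ (n + 1) / (Nat.factorial (n + 1) : ℝ)) (0, q) := by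
    fun_prop
  simpa [ContinuousAt] using h

lemma knightDomain_mem_nhds (hφ : ∀ l, 1 ≤ l → l ≤ k → IsFlow r (ξ l) (Dom l) (φ l)) {n : ℕ}
    (hn : n ≤ k) (q : M) : knightDomain Dom φ n ∈ 𝓝 ((0 : ℝ), q) := by
  refine (eventually_all_finite (finite_lt_nat n)).2 fun l hl => ?_
  have hl : l < n := hl
  have hf := hφ (l + 1) (by omega) (by omega)
  exact (tendsto_knight_step hφ (by omega) q).eventually (hf.isOpen.mem_nhds (hf.zero_mem q))

lemma isLittleO_knight_succ (hr : 1 ≤ r)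
    (hφ : ∀ l, 1 ≤ l → l ≤ k → IsFlow r (ξ l) (Dom l) (φ l)) {n : ℕ} (hn : n < k) {p q : M}
    (hq : q ∈ (extChartAt 𝓘(ℝ, E) p).source) :
    (fun x : ℝ × M => extChartAt 𝓘(ℝ, E) p (knight φ (n + 1) x.1 x.2) -
      extChartAt 𝓘(ℝ, E) p (knight φ n x.1 x.2) -
      (x.1 ^ (n + 1) / (Nat.factorial (n + 1) : ℝ)) • chartVec (ξ (n + 1)) p q)
      =o[𝓝 (0, q)] fun x => x.1 ^ (n + 1) := by
  have h := ((hφ (n + 1) (by omega) hn).isLittleO_chart hr hq).comp_tendsto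
    (tendsto_knight_step hφ hn.le q)
  refine h.trans_isBigO ?_
  refine IsBigO.congr_left ((isBigO_refl (fun x : ℝ × M => x.1 ^ (n + 1)) _).const_mul_left
    (Nat.factorial (n + 1) : ℝ)⁻¹) fun x => ?_
  simp [div_eq_inv_mul]

lemma isLittleO_fst_pow {i j : ℕ} (hij : i < j) (q : M) :
    (fun x : ℝ × M => x.1 ^ j) =o[𝓝 (0, q)] fun x => x.1 ^ i :=
  (isLittleO_pow_pow hij).comp_tendsto (continuousAt_fst (p := ((0 : ℝ), q)))

/-- Expansion of a knight composition beyond its first `j` steps. -/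
lemma isLittleO_knight (hr : 1 ≤ r)
    (hφ : ∀ l, 1 ≤ l → l ≤ k → IsFlow r (ξ l) (Dom l) (φ l)) {j n : ℕ} (hjn : j + 1 ≤ n)
    (hn : n ≤ k) {p q : M} (hq : q ∈ (extChartAt 𝓘(ℝ, E) p).source) :
    (fun x : ℝ × M => extChartAt 𝓘(ℝ, E) p (knight φ n x.1 x.2) -
      extChartAt 𝓘(ℝ, E) p (knight φ j x.1 x.2) -
      (x.1 ^ (j + 1) / (Nat.factorial (j + 1) : ℝ)) • chartVec (ξ (j + 1)) p q)
      =o[𝓝 (0, q)] fun x => x.1 ^ (j + 1) := by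
  induction n, hjn using Nat.le_induction with
  | base => exact isLittleO_knight_succ hr hφ hn hq
  | succ n hjn ih =>
    have h1 := (isLittleO_knight_succ hr hφ (show n < k by omega) hq).trans
      (isLittleO_fst_pow (show j + 1 < n + 1 by omega) q)
    have h2 : (fun x : ℝ × M => (x.1 ^ (n + 1) / (Nat.factorial (n + 1) : ℝ)) •
        chartVec (ξ (n + 1)) p q) =o[𝓝 (0, q)] fun x => x.1 ^ (j + 1) := by
      refine IsBigO.trans_isLittleO ?_ (isLittleO_fst_pow (show j + 1 < n + 1 by omega) q)
      refine IsBigO.of_bound (‖(Nat.factorial (n + 1) : ℝ)⁻¹‖ * ‖chartVec (ξ (n + 1)) p q‖)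
        (Eventually.of_forall fun x => le_of_eq ?_)
      rw [norm_smul, div_eq_mul_inv, norm_mul]; ring
    refine ((ih (by omega)).add (h1.add h2)).congr_left fun x => ?_
    abel

lemma contDiffAt_chart_knight (hr : 1 ≤ r)
    (hφ : ∀ l, 1 ≤ l → l ≤ k → IsFlow r (ξ l) (Dom l) (φ l)) {n : ℕ} (hn : n ≤ k) (p : M) :
    ContDiffAt ℝ 1 (fun t => extChartAt 𝓘(ℝ, E) p (knight φ n t p)) 0 := by
  have h1 : ContMDiffAt 𝓘(ℝ, ℝ) 𝓘(ℝ, E) 1 (fun t => knight φ n t p) (0 : ℝ) :=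
    ContMDiffAt.comp (0 : ℝ) (g := fun x : ℝ × M => knight φ n x.1 x.2) (f := fun t => (t, p))
      ((contMDiffAt_knight hφ hn p).of_le (by exact_mod_cast hr))
      (contMDiffAt_id.prodMk contMDiffAt_const)
  have h2 : ContMDiffAt 𝓘(ℝ, ℝ) 𝓘(ℝ, E) 1
      (fun t => extChartAt 𝓘(ℝ, E) p (knight φ n t p)) (0 : ℝ) :=
    ContMDiffAt.comp (0 : ℝ) (g := extChartAt 𝓘(ℝ, E) p)
      (by rw [knight_zero_left hφ hn]; exact contMDiffAt_extChartAt) h1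
  exact h2.contDiffAt

lemma tendsto_knight_left (hφ : ∀ l, 1 ≤ l → l ≤ k → IsFlow r (ξ l) (Dom l) (φ l)) {n : ℕ}
    (hn : n ≤ k) (p : M) : Tendsto (fun t => knight φ n t p) (𝓝 0) (𝓝 p) :=
  (tendsto_knight hφ hn p).comp (Continuous.prodMk_left p).continuousAt

/-- An `o`-estimate cannot be differentiated, so velocities are expanded directly. By the chain rule
the new velocity is `fderiv G` at `(τ t, z t)` applied to `(τ' t, z' t)`; at `(0, e p)` this
derivative is `(a, b) ↦ a • ξ (n + 1) p + b`, and its continuity turns the `O(t ^ j)` vector into an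
`o(t ^ j)` error. -/
lemma isLittleO_deriv_knight_succ (hr : 1 ≤ r)
    (hφ : ∀ l, 1 ≤ l → l ≤ k → IsFlow r (ξ l) (Dom l) (φ l)) {j n : ℕ} (hjn : j ≤ n) (hn : n < k)
    (p : M) (hO : deriv (fun t => extChartAt 𝓘(ℝ, E) p (knight φ n t p)) =O[𝓝 0]
      fun t => t ^ j) :
    (fun t => deriv (fun t => extChartAt 𝓘(ℝ, E) p (knight φ (n + 1) t p)) t -
      deriv (fun t => extChartAt 𝓘(ℝ, E) p (knight φ n t p)) t -
      (t ^ n / (Nat.factorial n : ℝ)) • chartVec (ξ (n + 1)) p p) =o[𝓝 0] fun t => t ^ j := by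
  have hf := hφ (n + 1) (by omega) hn
  have hps := mem_extChartAt_source (I := 𝓘(ℝ, E)) p
  have hC := hf.contDiffAt_chart hr hps
  have hL := (hf.hasStrictFDerivAt_chart hr hps).hasFDerivAt.fderiv
  have hsrc := (tendsto_knight_left hφ hn.le p).eventually
    (extChartAt_source_mem_nhds (I := 𝓘(ℝ, E)) p)
  set e := extChartAt 𝓘(ℝ, E) p with he
  set G : ℝ × E → E := fun x => e (φ (n + 1) x.1 (e.symm x.2)) with hG
  set z : ℝ → E := fun t => e (knight φ n t p) with hz
  set τ : ℝ → ℝ := fun t => t ^ (n + 1) / (Nat.factorial (n + 1) : ℝ) with hτ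
  have hz0 : z 0 = e p := by rw [hz]; simp only [knight_zero_left hφ hn.le]
  have hzC : ContDiffAt ℝ 1 z 0 := contDiffAt_chart_knight hr hφ hn.le p
  have hτd : ∀ t, HasDerivAt τ (t ^ n / (Nat.factorial n : ℝ)) t := by
    intro t
    have h1 := (hasDerivAt_pow (n + 1) t).div_const (Nat.factorial (n + 1) : ℝ)
    convert! h1 using 1
    have : (Nat.factorial n : ℝ) ≠ 0 := by positivity
    have : (n + 1 : ℝ) ≠ 0 := by positivity
    rw [Nat.factorial_succ]
    push_cast
    field_simp
  have hlim : Tendsto (fun t => (τ t, z t)) (𝓝 0) (𝓝 (0, e p)) := by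
    refine Tendsto.prodMk_nhds ?_ ?_
    · have := (hτd 0).continuousAt.tendsto
      simpa [hτ] using this
    · rw [← hz0]; exact hzC.continuousAt
  have heq : (fun t => e (knight φ (n + 1) t p)) =ᶠ[𝓝 0] fun t => G (τ t, z t) := by
    filter_upwards [hsrc] with t ht
    simp only [hG, hz, e.left_inv ht, knight, hτ]
  have hderiv : ∀ᶠ t in 𝓝 0, deriv (fun t => e (knight φ (n + 1) t p)) t =
      fderiv ℝ G (τ t, z t) (t ^ n / (Nat.factorial n : ℝ), deriv z t) := by
    filter_upwards [heq.eventuallyEq_nhds, hzC.eventually (by simp),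
      hlim.eventually (hC.eventually (by simp))] with t h1 h2 h3
    rw [h1.deriv_eq]
    have h4 := (h2.differentiableAt one_ne_zero).hasDerivAt
    have h5 := (h3.differentiableAt one_ne_zero).hasFDerivAt
    exact (HasFDerivAt.comp_hasDerivAt t (f := fun t => (τ t, z t)) h5
      ((hτd t).prodMk h4)).deriv
  have hcont : Tendsto (fun t => fderiv ℝ G (τ t, z t) - fderiv ℝ G (0, e p)) (𝓝 0) (𝓝 0) := by
    have h1 : ContinuousAt (fderiv ℝ G) (0, e p) :=
      (hC.fderiv_right (m := 0) (by simp)).continuousAt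
    have h2 := (h1.tendsto.comp hlim).sub_const (fderiv ℝ G (0, e p))
    simpa using h2
  have hpow : (fun t : ℝ => t ^ n) =O[𝓝 0] fun t => t ^ j := by
    refine IsBigO.of_bound 1 ?_
    filter_upwards [Metric.ball_mem_nhds (0 : ℝ) one_pos] with t ht
    rw [mem_ball_zero_iff] at ht
    rw [norm_pow, norm_pow, one_mul]
    exact pow_le_pow_of_le_one (norm_nonneg _) ht.le hjn
  have hpair : (fun t => (t ^ n / (Nat.factorial n : ℝ), deriv z t)) =O[𝓝 0] fun t => t ^ j := by
    refine IsBigO.prod_left ?_ hO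
    simpa [div_eq_mul_inv, mul_comm] using hpow.const_mul_left (Nat.factorial n : ℝ)⁻¹
  have hlittle : (fun t => (fderiv ℝ G (τ t, z t) - fderiv ℝ G (0, e p))
      (t ^ n / (Nat.factorial n : ℝ), deriv z t)) =o[𝓝 0] fun t => t ^ j := by
    have h1 := ((isLittleO_one_iff ℝ).2 hcont).norm_left.mul_isBigO hpair.norm_norm
    simp only [one_mul] at h1
    refine IsBigO.trans_isLittleO (IsBigO.of_bound 1 (Eventually.of_forall fun t => ?_))
      h1.of_norm_right
    rw [one_mul, norm_mul, norm_norm, norm_norm]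
    exact ContinuousLinearMap.le_opNorm _ _
  refine hlittle.congr' ?_ EventuallyEq.rfl
  filter_upwards [hderiv] with t ht
  rw [ht, sub_apply, hL]
  simp
  abel

variable [T2Space M]

lemma knight_eq_of_eq_zero (hr : 1 ≤ r)
    (hφ : ∀ l, 1 ≤ l → l ≤ k → IsFlow r (ξ l) (Dom l) (φ l)) {n : ℕ} (hn : n ≤ k)
    (h0 : ∀ l, 1 ≤ l → l ≤ n → ∀ p, ξ l p = 0) {x : ℝ × M} (hx : x ∈ knightDomain Dom φ n) :
    knight φ n x.1 x.2 = x.2 := by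
  induction n with
  | zero => rfl
  | succ n ih =>
    have hf := hφ (n + 1) (by omega) hn
    have h1 := (hf.flowsTo (hx n (by omega))).eq_of_eq_zero (hf.field_contMDiff_one hr)
      (h0 (n + 1) (by omega) le_rfl)
    rw [knight, h1]
    exact ih (by omega) (fun l h1 h2 => h0 l h1 (by omega)) fun l hl => hx l (by omega)

/-- The leading term of a knight composition whose first `j` generators vanish. -/
lemma isLittleO_knight_of_eq_zero (hr : 1 ≤ r)
    (hφ : ∀ l, 1 ≤ l → l ≤ k → IsFlow r (ξ l) (Dom l) (φ l)) {j n : ℕ} (hjn : j + 1 ≤ n)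
    (hn : n ≤ k) (h0 : ∀ l, 1 ≤ l → l ≤ j → ∀ p, ξ l p = 0) {p q : M}
    (hq : q ∈ (extChartAt 𝓘(ℝ, E) p).source) :
    (fun x : ℝ × M => extChartAt 𝓘(ℝ, E) p (knight φ n x.1 x.2) - extChartAt 𝓘(ℝ, E) p x.2 -
      (x.1 ^ (j + 1) / (Nat.factorial (j + 1) : ℝ)) • chartVec (ξ (j + 1)) p q)
      =o[𝓝 (0, q)] fun x => x.1 ^ (j + 1) := by
  refine (isLittleO_knight hr hφ hjn hn hq).congr' ?_ EventuallyEq.rfl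
  filter_upwards [knightDomain_mem_nhds hφ (show j ≤ k by omega) q] with x hx
  rw [knight_eq_of_eq_zero hr hφ (by omega) h0 hx]

/-- The leading term of the velocity of a knight composition whose first `j` generators vanish. -/
lemma isLittleO_deriv_knight (hr : 1 ≤ r)
    (hφ : ∀ l, 1 ≤ l → l ≤ k → IsFlow r (ξ l) (Dom l) (φ l)) {j n : ℕ} (hjn : j + 1 ≤ n)
    (hn : n ≤ k) (h0 : ∀ l, 1 ≤ l → l ≤ j → ∀ p, ξ l p = 0) (p : M) :
    (fun t => deriv (fun t => extChartAt 𝓘(ℝ, E) p (knight φ n t p)) t -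
      (t ^ j / (Nat.factorial j : ℝ)) • chartVec (ξ (j + 1)) p p) =o[𝓝 0] fun t => t ^ j := by
  induction n, hjn using Nat.le_induction with
  | base =>
    have h1 : deriv (fun t => extChartAt 𝓘(ℝ, E) p (knight φ j t p)) =ᶠ[𝓝 0] fun _ => 0 := by
      have h2 : (fun t => extChartAt 𝓘(ℝ, E) p (knight φ j t p)) =ᶠ[𝓝 0]
          fun _ => extChartAt 𝓘(ℝ, E) p p := by
        filter_upwards [(Continuous.prodMk_left p).continuousAt.eventually
          (knightDomain_mem_nhds hφ (show j ≤ k by omega) p)] with t ht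
        rw [knight_eq_of_eq_zero hr hφ (by omega) h0 (x := (t, p)) ht]
      filter_upwards [h2.eventuallyEq_nhds] with t ht
      rw [ht.deriv_eq, deriv_const]
    have h2 := isLittleO_deriv_knight_succ hr hφ le_rfl hn p
      (h1.trans_isBigO (isBigO_zero _ _))
    refine h2.congr' ?_ EventuallyEq.rfl
    filter_upwards [h1] with t ht
    rw [ht, sub_zero]
  | succ n hjn ih =>
    have ih := ih (by omega)
    have hpow : ∀ (i : ℕ) (w : E), (fun t : ℝ => (t ^ i / (Nat.factorial i : ℝ)) • w) =O[𝓝 0]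
        fun t => t ^ i := fun i w => IsBigO.of_bound (‖(Nat.factorial i : ℝ)⁻¹‖ * ‖w‖)
          (Eventually.of_forall fun x => le_of_eq (by
            rw [norm_smul, div_eq_mul_inv, norm_mul]; ring))
    have hO : deriv (fun t => extChartAt 𝓘(ℝ, E) p (knight φ n t p)) =O[𝓝 0] fun t => t ^ j :=
      (ih.isBigO.add (hpow j (chartVec (ξ (j + 1)) p p))).congr_left fun t => sub_add_cancel _ _
    have h1 := isLittleO_deriv_knight_succ hr hφ (show j ≤ n by omega) (show n < k by omega) p hO
    have h2 := (hpow n (chartVec (ξ (n + 1)) p p)).trans_isLittleO (isLittleO_pow_pow (show j < n by omega))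
    refine (ih.add (h1.add h2)).congr_left fun t => ?_
    abel

end KnightExpansion

/-! ### Local groups with a leading field -/

section LeadingField

open Set Filter Asymptotics

variable {E : Type*} [NormedAddCommGroup E] [NormedSpace ℝ E]
  {M : Type*} [TopologicalSpace M] [ChartedSpace E M] [IsManifold 𝓘(ℝ, E) 1 M]

/-- To leading order in `t`, the local maps `Ψ t` move points by `t ^ (j + 1) / (j + 1)!` along the
`C^1` field `X`, together with their velocities. -/
structure HasLeadingField (j : ℕ) (X : (p : M) → TangentSpace 𝓘(ℝ, E) p) (D : Set (ℝ × M))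
    (Ψ : ℝ → M → M) : Prop where
  contMDiff : ContMDiff 𝓘(ℝ, E) (𝓘(ℝ, E)).tangent 1
    (fun p => (⟨p, X p⟩ : TangentBundle 𝓘(ℝ, E) M))
  isOpen : IsOpen D
  zero_mem : ∀ p, ((0 : ℝ), p) ∈ D
  map_zero : ∀ p, Ψ 0 p = p
  tendsto : ∀ p, Tendsto (fun x : ℝ × M => Ψ x.1 x.2) (𝓝 (0, p)) (𝓝 p)
  isLittleO : ∀ p, ∀ q ∈ (extChartAt 𝓘(ℝ, E) p).source,
    (fun x : ℝ × M => extChartAt 𝓘(ℝ, E) p (Ψ x.1 x.2) - extChartAt 𝓘(ℝ, E) p x.2 -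
      (x.1 ^ (j + 1) / (Nat.factorial (j + 1) : ℝ)) • chartVec X p q)
      =o[𝓝 (0, q)] fun x => x.1 ^ (j + 1)
  contDiffAt : ∀ p, ContDiffAt ℝ 1 (fun t => extChartAt 𝓘(ℝ, E) p (Ψ t p)) 0
  isLittleO_deriv : ∀ p, (fun t => deriv (fun t => extChartAt 𝓘(ℝ, E) p (Ψ t p)) t -
      (t ^ j / (Nat.factorial j : ℝ)) • chartVec X p p) =o[𝓝 0] fun t => t ^ j

lemma eventually_zero_prod_iff {P : ℝ → ℝ → Prop} :
    (∀ᶠ x : ℝ × ℝ in 𝓝 (0, 0), P x.1 x.2) ↔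
      ∃ ρ > 0, ∀ a b, |a| < ρ → |b| < ρ → P a b := by
  rw [Metric.eventually_nhds_iff]
  constructor
  · rintro ⟨ρ, hρ, h⟩
    exact ⟨ρ, hρ, fun a b ha hb => @h (a, b) (by simpa [Prod.dist_eq] using ⟨ha, hb⟩)⟩
  · rintro ⟨ρ, hρ, h⟩
    refine ⟨ρ, hρ, fun x hx => ?_⟩
    rw [Prod.dist_eq] at hx
    exact h _ _ (by simpa using (le_max_left _ _).trans_lt hx)
      (by simpa using (le_max_right _ _).trans_lt hx)

lemma eventually_zero_iff {P : ℝ → Prop} :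
    (∀ᶠ t in 𝓝 (0 : ℝ), P t) ↔ ∃ ρ > 0, ∀ t, |t| < ρ → P t := by
  simp [Metric.eventually_nhds_iff]

variable {j : ℕ} {X : (p : M) → TangentSpace 𝓘(ℝ, E) p} {D : Set (ℝ × M)} {Ψ : ℝ → M → M}

namespace HasLeadingField

variable (h : HasLeadingField j X D Ψ)
include h

lemma tendsto_left (p : M) : Tendsto (fun t => Ψ t p) (𝓝 0) (𝓝 p) :=
  (h.tendsto p).comp (Continuous.prodMk_left p).continuousAt

lemma eventually_mem (p : M) : ∀ᶠ t in 𝓝 (0 : ℝ), (t, p) ∈ D :=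
  (Continuous.prodMk_left p).continuousAt.eventually (h.isOpen.mem_nhds (h.zero_mem p))

/-- A group whose leading order is even could only move points forward along `X`. -/
lemma even_of_formsLocalGroup (hG : FormsLocalGroup D Ψ) {p : M} {ℓ : E →L[ℝ] ℝ}
    (hℓ : 0 < ℓ (chartVec X p p)) : Even j := by
  by_contra hodd
  have heven : Even (j + 1) := (Nat.not_even_iff_odd.1 hodd).add_one
  set e := extChartAt 𝓘(ℝ, E) p with he
  have h1 := (ℓ.isBigO_comp (fun x : ℝ × M => e (Ψ x.1 x.2) - e x.2 -
      (x.1 ^ (j + 1) / (Nat.factorial (j + 1) : ℝ)) • chartVec X p p) (𝓝 (0, p))).trans_isLittleO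
      (h.isLittleO p p (mem_extChartAt_source p))
  have hfac : (0 : ℝ) < Nat.factorial (j + 1) := by positivity
  have h2 : ∀ᶠ x : ℝ × M in 𝓝 (0, p), ℓ (e x.2) +
      x.1 ^ (j + 1) / (Nat.factorial (j + 1) : ℝ) * (ℓ (chartVec X p p) / 2) ≤
      ℓ (e (Ψ x.1 x.2)) := by
    -- The constant makes the error at most half of the leading term.
    filter_upwards [h1.def (c := ℓ (chartVec X p p) / 2 / (Nat.factorial (j + 1) : ℝ))
      (by positivity)] with x hx
    rw [Real.norm_eq_abs, Real.norm_of_nonneg (heven.pow_nonneg _), map_sub, map_sub, map_smul,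
      smul_eq_mul] at hx
    have h3 := (abs_le.1 hx).1
    have h4 : ℓ (chartVec X p p) / 2 / (Nat.factorial (j + 1) : ℝ) * x.1 ^ (j + 1) =
      x.1 ^ (j + 1) / (Nat.factorial (j + 1) : ℝ) * (ℓ (chartVec X p p) / 2) := by ring
    rw [h4] at h3
    linarith
  have hpair : Tendsto (fun x : ℝ × ℝ => (x.1, Ψ x.2 p)) (𝓝 (0, 0)) (𝓝 (0, p)) :=
    Tendsto.prodMk_nhds continuousAt_fst ((h.tendsto_left p).comp continuousAt_snd)
  have hsnd : Tendsto (fun x : ℝ × ℝ => (x.2, p)) (𝓝 (0, 0)) (𝓝 (0, p)) :=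
    Tendsto.prodMk_nhds continuousAt_snd tendsto_const_nhds
  have hD := h.isOpen.mem_nhds (h.zero_mem p)
  obtain ⟨ρ, hρ, hall⟩ := eventually_zero_prod_iff
    (P := fun v t => ((ℓ (e (Ψ t p)) + v ^ (j + 1) / (Nat.factorial (j + 1) : ℝ) *
        (ℓ (chartVec X p p) / 2) ≤ ℓ (e (Ψ v (Ψ t p)))) ∧
      (ℓ (e p) + t ^ (j + 1) / (Nat.factorial (j + 1) : ℝ) * (ℓ (chartVec X p p) / 2) ≤
        ℓ (e (Ψ t p)))) ∧ (v, Ψ t p) ∈ D ∧ (t, p) ∈ D).1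
    (((hpair.eventually h2).and (hsnd.eventually h2)).and
      ((hpair.eventually hD).and (hsnd.eventually hD)))
  obtain ⟨δ, hδ, -, hinv⟩ := hG ρ hρ
  have ht0 : 0 < min δ ρ / 2 := by positivity
  have htabs : |min δ ρ / 2| = min δ ρ / 2 := abs_of_pos ht0
  obtain ⟨v, hv, hvt, -⟩ := hinv (min δ ρ / 2) (by rw [htabs]; linarith [min_le_left δ ρ])
  obtain ⟨⟨h5, h6⟩, h7, h8⟩ := hall v (min δ ρ / 2) hv (by rw [htabs]; linarith [min_le_right δ ρ])
  -- Both `Ψ t` and its inverse `Ψ v` do not decrease `ℓ`, and `Ψ t` strictly increases it at `p`,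
  -- yet together they return to `p`.
  rw [hvt p h8 h7] at h5
  have h9 : 0 ≤ v ^ (j + 1) / (Nat.factorial (j + 1) : ℝ) * (ℓ (chartVec X p p) / 2) :=
    mul_nonneg (div_nonneg (heven.pow_nonneg v) hfac.le) (by positivity)
  have h10 : 0 < (min δ ρ / 2) ^ (j + 1) / (Nat.factorial (j + 1) : ℝ) *
    (ℓ (chartVec X p p) / 2) := by positivity
  linarith

lemma eventually_hasDerivAt (p : M) : ∀ᶠ t in 𝓝 (0 : ℝ),
    HasDerivAt (fun t => extChartAt 𝓘(ℝ, E) p (Ψ t p))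
      (deriv (fun t => extChartAt 𝓘(ℝ, E) p (Ψ t p)) t) t := by
  filter_upwards [(h.contDiffAt p).eventually (by simp)] with t ht
  exact (ht.differentiableAt one_ne_zero).hasDerivAt

lemma eventually_deriv_pos (hj : Even j) {p : M} {ℓ : E →L[ℝ] ℝ}
    (hℓ : 0 < ℓ (chartVec X p p)) : ∀ᶠ t in 𝓝 (0 : ℝ), t ≠ 0 →
      0 < ℓ (deriv (fun t => extChartAt 𝓘(ℝ, E) p (Ψ t p)) t) := by
  have h1 := (ℓ.isBigO_comp _ (𝓝 0)).trans_isLittleO (h.isLittleO_deriv p)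
  filter_upwards [h1.def (c := ℓ (chartVec X p p) / 2 / (Nat.factorial j : ℝ))
      (by positivity)] with t ht ht0
  rw [Real.norm_eq_abs, Real.norm_of_nonneg (hj.pow_nonneg _), map_sub, map_smul,
    smul_eq_mul] at ht
  have h3 := (abs_le.1 ht).1
  have h4 : ℓ (chartVec X p p) / 2 / (Nat.factorial j : ℝ) * t ^ j =
      t ^ j / (Nat.factorial j : ℝ) * (ℓ (chartVec X p p) / 2) := by ring
  have h5 : 0 < t ^ j / (Nat.factorial j : ℝ) * (ℓ (chartVec X p p) / 2) := by
    have := hj.pow_pos ht0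
    positivity
  rw [h4] at h3
  linarith

/-- The derivative may vanish at `0`, so monotonicity is proved on each side and glued there. -/
lemma exists_strictMonoOn (hj : Even j) {p : M} {ℓ : E →L[ℝ] ℝ}
    (hℓ : 0 < ℓ (chartVec X p p)) : ∃ ρ₀ > 0, ∀ ρ ≤ ρ₀,
      StrictMonoOn (fun t => ℓ (extChartAt 𝓘(ℝ, E) p (Ψ t p))) (Ioo (-ρ) ρ) := by
  obtain ⟨ρ, hρ, hall⟩ := eventually_zero_iff.1
    ((h.eventually_hasDerivAt p).and (h.eventually_deriv_pos hj hℓ))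
  refine ⟨ρ, hρ, fun ρ' hρ' => StrictMonoOn.mono ?_ (Ioo_subset_Ioo (neg_le_neg hρ') hρ')⟩
  have hd : ∀ t ∈ Ioo (-ρ) ρ, HasDerivAt (fun t => ℓ (extChartAt 𝓘(ℝ, E) p (Ψ t p)))
      (ℓ (deriv (fun t => extChartAt 𝓘(ℝ, E) p (Ψ t p)) t)) t := fun t ht =>
    ℓ.hasFDerivAt.comp_hasDerivAt t (hall t (abs_lt.2 ht)).1
  have h1 : StrictMonoOn (fun t => ℓ (extChartAt 𝓘(ℝ, E) p (Ψ t p))) (Ioc (-ρ) 0) := by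
    have hsub : Ioc (-ρ) 0 ⊆ Ioo (-ρ) ρ := fun t ht => ⟨ht.1, ht.2.trans_lt hρ⟩
    refine strictMonoOn_of_deriv_pos (convex_Ioc _ _)
      (fun t ht => (hd t (hsub ht)).continuousAt.continuousWithinAt) fun t ht => ?_
    rw [interior_Ioc] at ht
    have ht' := hsub (Ioo_subset_Ioc_self ht)
    rw [(hd t ht').deriv]
    exact (hall t (abs_lt.2 ht')).2 ht.2.ne
  have h2 : StrictMonoOn (fun t => ℓ (extChartAt 𝓘(ℝ, E) p (Ψ t p))) (Ico 0 ρ) := by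
    have hsub : Ico 0 ρ ⊆ Ioo (-ρ) ρ := fun t ht => ⟨by linarith [ht.1], ht.2⟩
    refine strictMonoOn_of_deriv_pos (convex_Ico _ _)
      (fun t ht => (hd t (hsub ht)).continuousAt.continuousWithinAt) fun t ht => ?_
    rw [interior_Ico] at ht
    have ht' := hsub (Ioo_subset_Ico_self ht)
    rw [(hd t ht').deriv]
    exact (hall t (abs_lt.2 ht')).2 ht.1.ne'
  have h3 := h1.union h2 (c := 0) ⟨⟨by linarith, le_rfl⟩, fun t ht => ht.2⟩
    ⟨⟨le_rfl, hρ⟩, fun t ht => ht.1⟩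
  rwa [Ioc_union_Ico_eq_Ioo (by linarith) hρ] at h3

lemma tendsto_smul_sub (p : M) {q : M} (hq : q ∈ (extChartAt 𝓘(ℝ, E) p).source) :
    Tendsto (fun s : ℝ => ((Nat.factorial (j + 1) : ℝ) / s ^ (j + 1)) •
      (extChartAt 𝓘(ℝ, E) p (Ψ s q) - extChartAt 𝓘(ℝ, E) p q)) (𝓝[≠] 0)
      (𝓝 (chartVec X p q)) := by
  have h1 := (h.isLittleO p q hq).comp_tendsto
    ((Continuous.prodMk_left q).tendsto' (0 : ℝ) (0, q) rfl)
  have h2 := (h1.mono (nhdsWithin_le_nhds (s := {0}ᶜ))).tendsto_inv_smul_nhds_zero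
  have h3 := (h2.const_smul (Nat.factorial (j + 1) : ℝ)).add_const (chartVec X p q)
  rw [smul_zero, zero_add] at h3
  refine h3.congr' ?_
  filter_upwards [self_mem_nhdsWithin] with s hs
  have hs : s ≠ 0 := hs
  have hf : (Nat.factorial (j + 1) : ℝ) ≠ 0 := by positivity
  simp only [Function.comp, smul_sub, smul_smul]
  rw [show (Nat.factorial (j + 1) : ℝ) * ((s ^ (j + 1))⁻¹ *
    (s ^ (j + 1) / (Nat.factorial (j + 1) : ℝ))) = 1 by field_simp]
  rw [div_eq_mul_inv, one_smul, sub_add_cancel]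

end HasLeadingField

lemma HasDerivAt.tendsto_dslope {f : ℝ → E} {f' : E} {t : ℝ} {U : ℝ → ℝ} {l : Filter ℝ}
    (hf : HasDerivAt f f' t) (hU : Tendsto U l (𝓝 t)) :
    Tendsto (fun s => dslope f t (U s)) l (𝓝 f') := by
  have h1 := (continuousAt_dslope_same.2 hf.differentiableAt).tendsto.comp hU
  rwa [dslope_same, hf.deriv] at h1

/-- If `U s → t`, then the limits of the rescaled increments of `z` and `g` along `U` are in the
same proportion as the derivatives of `z` and `g` at `t`. -/
lemma eq_smul_deriv_of_tendsto {z : ℝ → E} {z' w : E} {g : ℝ → ℝ} {g' a t : ℝ} {U b : ℝ → ℝ}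
    {l : Filter ℝ} [l.NeBot] (hz : HasDerivAt z z' t) (hg : HasDerivAt g g' t) (hg' : g' ≠ 0)
    (hU : Tendsto U l (𝓝 t)) (hzl : Tendsto (fun s => b s • (z (U s) - z t)) l (𝓝 w))
    (hgl : Tendsto (fun s => b s * (g (U s) - g t)) l (𝓝 a)) : w = (a / g') • z' := by
  -- `dslope` replaces the difference quotient because `U s` may equal `t`.
  have h1 : Tendsto (fun s => b s * (U s - t)) l (𝓝 (a / g')) := by
    refine (hgl.div (hg.tendsto_dslope hU) hg').congr' ?_
    filter_upwards [(hg.tendsto_dslope hU).eventually_ne hg'] with s hs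
    rw [Pi.div_apply, ← sub_smul_dslope g t (U s), smul_eq_mul]
    field_simp
  refine tendsto_nhds_unique hzl ((h1.smul (hz.tendsto_dslope hU)).congr fun s => ?_)
  rw [mul_smul, sub_smul_dslope]

namespace HasLeadingField

/-- In a group, the velocity of `Ψ t p` is a multiple of the leading field, by a factor which does
not depend on `p`. -/
lemma eventually_deriv_eq (h : HasLeadingField j X D Ψ) (hG : FormsLocalGroup D Ψ) {p₀ : M}
    {ℓ : E →L[ℝ] ℝ} (hℓ : 0 < ℓ (chartVec X p₀ p₀)) (p : M) :
    ∀ᶠ t in 𝓝 (0 : ℝ), t ≠ 0 → chartVec X p (Ψ t p) =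
      (ℓ (chartVec X p₀ (Ψ t p₀)) / ℓ (deriv (fun t => extChartAt 𝓘(ℝ, E) p₀ (Ψ t p₀)) t)) •
        deriv (fun t => extChartAt 𝓘(ℝ, E) p (Ψ t p)) t := by
  have hj := h.even_of_formsLocalGroup hG hℓ
  obtain ⟨ρ₀, hρ₀, hmono⟩ := h.exists_strictMonoOn hj hℓ
  obtain ⟨ρ₁, hρ₁, hall⟩ := eventually_zero_iff.1 ((((h.eventually_hasDerivAt p).and
    (h.eventually_hasDerivAt p₀)).and ((h.eventually_mem p).and (h.eventually_mem p₀))).and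
    (((h.tendsto_left p).eventually (extChartAt_source_mem_nhds (I := 𝓘(ℝ, E)) p)).and
    (((h.tendsto_left p₀).eventually (extChartAt_source_mem_nhds (I := 𝓘(ℝ, E)) p₀)).and
    (h.eventually_deriv_pos hj hℓ))))
  set ρ := min ρ₀ ρ₁ with hρdef
  have hρ : 0 < ρ := lt_min hρ₀ hρ₁
  replace hmono := hmono ρ (min_le_left _ _)
  replace hall := fun t (ht : |t| < ρ) => hall t (ht.trans_le (min_le_right _ _))
  -- Taking `ε = ρ` keeps the composed parameters where both orbits are defined and `ℓ` is monotone.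
  obtain ⟨δ, hδ, hcomp, -⟩ := hG ρ hρ
  refine eventually_zero_iff.2 ⟨min δ ρ, lt_min hδ hρ, fun t ht ht0 => ?_⟩
  have htδ := ht.trans_le (min_le_left _ _)
  have htρ := ht.trans_le (min_le_right _ _)
  obtain ⟨⟨⟨hz, hy⟩, hDp, hDp₀⟩, hsp, hsp₀, hpos⟩ := hall t htρ
  have hex : ∀ s, ∃ u, |s| < δ → |u| < ρ ∧
      ∀ p, (t, p) ∈ D → (s, Ψ t p) ∈ D → (u, p) ∈ D → Ψ s (Ψ t p) = Ψ u p := by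
    intro s
    by_cases hs : |s| < δ
    · obtain ⟨u, hu⟩ := hcomp s t hs htδ
      exact ⟨u, fun _ => hu⟩
    · exact ⟨0, fun h => absurd h hs⟩
  choose U hU using hex
  have hlt : ∀ᶠ s in 𝓝 (0 : ℝ), |s| < δ := eventually_zero_iff.2 ⟨δ, hδ, fun _ h => h⟩
  have heq : ∀ q, (∀ u, |u| < ρ → (u, q) ∈ D) → ∀ᶠ s in 𝓝 (0 : ℝ), Ψ s (Ψ t q) = Ψ (U s) q := by
    intro q hq
    filter_upwards [hlt, h.eventually_mem (Ψ t q)] with s hs hsD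
    exact (hU s hs).2 q (hq t htρ) hsD (hq _ (hU s hs).1)
  have heqp := heq p fun u hu => (hall u hu).1.2.1
  have heqp₀ := heq p₀ fun u hu => (hall u hu).1.2.2
  set g : ℝ → ℝ := fun t => ℓ (extChartAt 𝓘(ℝ, E) p₀ (Ψ t p₀)) with hg
  have hgd : HasDerivAt g (ℓ (deriv (fun t => extChartAt 𝓘(ℝ, E) p₀ (Ψ t p₀)) t)) t :=
    ℓ.hasFDerivAt.comp_hasDerivAt t hy
  have hgU : Tendsto (fun s => g (U s)) (𝓝 0) (𝓝 (g t)) := by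
    have h1 : Tendsto (fun s => ℓ (extChartAt 𝓘(ℝ, E) p₀ (Ψ s (Ψ t p₀)))) (𝓝 0) (𝓝 (g t)) :=
      (ℓ.continuous.tendsto _).comp
        ((continuousAt_extChartAt' hsp₀).tendsto.comp (h.tendsto_left (Ψ t p₀)))
    refine h1.congr' ?_
    filter_upwards [heqp₀] with s hs
    rw [hs]
  have htmem : t ∈ Ioo (-ρ) ρ := abs_lt.1 htρ
  -- Strict monotonicity of `g` turns `g (U s) → g t` into `U s → t`.
  have hUt : Tendsto U (𝓝 0) (𝓝 t) := by
    refine tendsto_order.2 ⟨fun a ha => ?_, fun a ha => ?_⟩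
    · obtain ⟨a', ha1, ha2⟩ := exists_between (max_lt ha htmem.1)
      have ha'mem : a' ∈ Ioo (-ρ) ρ := ⟨(le_max_right _ _).trans_lt ha1, ha2.trans htmem.2⟩
      filter_upwards [hgU.eventually (lt_mem_nhds (hmono ha'mem htmem ha2)), hlt] with s hs hsδ
      exact ((le_max_left _ _).trans_lt ha1).trans
        ((hmono.lt_iff_lt ha'mem (abs_lt.1 (hU s hsδ).1)).1 hs)
    · obtain ⟨a', ha1, ha2⟩ := exists_between (lt_min ha htmem.2)
      have ha'mem : a' ∈ Ioo (-ρ) ρ := ⟨htmem.1.trans ha1, ha2.trans_le (min_le_right _ _)⟩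
      filter_upwards [hgU.eventually (gt_mem_nhds (hmono htmem ha'mem ha1)), hlt] with s hs hsδ
      exact ((hmono.lt_iff_lt (abs_lt.1 (hU s hsδ).1) ha'mem).1 hs).trans
        (ha2.trans_le (min_le_left _ _))
  have hle : 𝓝[≠] (0 : ℝ) ≤ 𝓝 0 := nhdsWithin_le_nhds
  refine eq_smul_deriv_of_tendsto (U := U) (l := 𝓝[≠] 0)
    (b := fun s => (Nat.factorial (j + 1) : ℝ) / s ^ (j + 1)) hz hgd (hpos ht0).ne'
    (hUt.mono_left hle) ?_ ?_
  · refine (h.tendsto_smul_sub p hsp).congr' ?_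
    filter_upwards [hle heqp] with s hs
    have hs : Ψ s (Ψ t p) = Ψ (U s) p := hs
    rw [hs]
  · refine ((ℓ.continuous.tendsto _).comp (h.tendsto_smul_sub p₀ hsp₀)).congr' ?_
    filter_upwards [hle heqp₀] with s hs
    have hs : Ψ s (Ψ t p₀) = Ψ (U s) p₀ := hs
    simp only [Function.comp, map_smul, map_sub, smul_eq_mul, hs, hg]

end HasLeadingField

end LeadingField

/-! ### A local group follows the flow of its leading field -/

section GroupFlow

open Set Filter Asymptotics

variable {E : Type*} [NormedAddCommGroup E] [NormedSpace ℝ E]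
  {M : Type*} [TopologicalSpace M] [ChartedSpace E M] [IsManifold 𝓘(ℝ, E) 1 M]
  {j : ℕ} {X : (p : M) → TangentSpace 𝓘(ℝ, E) p} {D : Set (ℝ × M)} {Ψ : ℝ → M → M}

lemma exists_eventually_hasDerivAt {f : ℝ → ℝ} (hf : ∀ᶠ t in 𝓝 (0 : ℝ), ContinuousAt f t) :
    ∃ F : ℝ → ℝ, F 0 = 0 ∧ ∀ᶠ t in 𝓝 (0 : ℝ), HasDerivAt F (f t) t := by
  obtain ⟨ρ, hρ, hball⟩ := Metric.eventually_nhds_iff_ball.1 hf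
  have hc : ContinuousOn f (Metric.ball 0 ρ) := fun t ht => (hball t ht).continuousWithinAt
  refine ⟨fun t => ∫ s in (0 : ℝ)..t, f s, intervalIntegral.integral_same, ?_⟩
  filter_upwards [Metric.ball_mem_nhds (0 : ℝ) hρ] with t ht
  have hsub : uIcc 0 t ⊆ Metric.ball 0 ρ := by
    rw [Real.ball_eq_Ioo] at ht ⊢
    exact ordConnected_Ioo.uIcc_subset ⟨by linarith, by linarith⟩ ht
  exact intervalIntegral.integral_hasDerivAt_right (hc.mono hsub).intervalIntegrable
    (hc.stronglyMeasurableAtFilter Metric.isOpen_ball t ht) (hball t ht)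

/-- Two curves in a chart which start at the centre of the chart and have velocity `f t • X` agree
near the initial time. -/
lemma eventuallyEq_of_hasDerivAt_smul (hX : ContMDiff 𝓘(ℝ, E) (𝓘(ℝ, E)).tangent 1
      (fun p => (⟨p, X p⟩ : TangentBundle 𝓘(ℝ, E) M))) {p : M} {f : ℝ → ℝ}
    (hf : ContinuousAt f 0) {γ γ' : ℝ → M} (hγ0 : γ 0 = p) (hγ0' : γ' 0 = p)
    (hγc : ContinuousAt γ 0) (hγc' : ContinuousAt γ' 0)
    (hγ : ∀ᶠ t in 𝓝 (0 : ℝ),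
      HasDerivAt (fun t => extChartAt 𝓘(ℝ, E) p (γ t)) (f t • chartVec X p (γ t)) t)
    (hγ' : ∀ᶠ t in 𝓝 (0 : ℝ),
      HasDerivAt (fun t => extChartAt 𝓘(ℝ, E) p (γ' t)) (f t • chartVec X p (γ' t)) t) :
    γ =ᶠ[𝓝 0] γ' := by
  obtain ⟨K, s, hs, hlip⟩ := (contDiffAt_chartVec hX p).exists_lipschitzOnWith
  set e := extChartAt 𝓘(ℝ, E) p with he
  set Z : E → E := fun y => chartVec X p (e.symm y) with hZ
  -- Any bound above `‖f 0‖` bounds `f` near `0`, giving one Lipschitz constant `C * K` for all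
  -- small times.
  set C : NNReal := ‖f 0‖₊ + 1 with hC
  have hfC : ∀ᶠ t in 𝓝 (0 : ℝ), ‖f t‖₊ ≤ C := by
    have := hf.nnnorm.eventually (gt_mem_nhds (show ‖f 0‖₊ < C by simp [hC]))
    exact this.mono fun t ht => ht.le
  have hv : ∀ᶠ t in 𝓝 (0 : ℝ), LipschitzOnWith (C * K) ((fun t y => f t • Z y) t) s := by
    filter_upwards [hfC] with t ht
    refine LipschitzOnWith.of_dist_le_mul fun x hx y hy => ?_
    have h1 : ‖f t‖ ≤ (C : ℝ) := ht
    rw [dist_smul₀, NNReal.coe_mul, mul_assoc]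
    exact mul_le_mul h1 (hlip.dist_le_mul x hx y hy) dist_nonneg C.coe_nonneg
  have key : ∀ g : ℝ → M, g 0 = p → ContinuousAt g 0 →
      (∀ᶠ t in 𝓝 (0 : ℝ), HasDerivAt (fun t => e (g t)) (f t • chartVec X p (g t)) t) →
      (∀ᶠ t in 𝓝 (0 : ℝ), g t ∈ e.source) ∧ ∀ᶠ t in 𝓝 (0 : ℝ),
        HasDerivAt (fun t => e (g t)) ((fun t y => f t • Z y) t (e (g t))) t ∧ e (g t) ∈ s := by
    intro g hg0 hgc hgd
    have h1 : ∀ᶠ t in 𝓝 (0 : ℝ), g t ∈ e.source := by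
      refine hgc.eventually ?_
      rw [hg0]
      exact extChartAt_source_mem_nhds (I := 𝓘(ℝ, E)) p
    have h2 : ∀ᶠ t in 𝓝 (0 : ℝ), e (g t) ∈ s := by
      have h3 : ContinuousAt (fun t => e (g t)) 0 :=
        ContinuousAt.comp (g := e) (by rw [hg0]; exact continuousAt_extChartAt p) hgc
      refine h3.eventually ?_
      simp only [hg0]
      exact hs
    refine ⟨h1, ?_⟩
    filter_upwards [h1, h2, hgd] with t ht1 ht2 ht3
    refine ⟨?_, ht2⟩
    simp only [hZ, e.left_inv ht1]
    exact ht3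
  obtain ⟨h1, h2⟩ := key γ hγ0 hγc hγ
  obtain ⟨h1', h2'⟩ := key γ' hγ0' hγc' hγ'
  have h3 := ODE_solution_unique_of_eventually (s := fun _ => s) hv h2 h2' (by rw [hγ0, hγ0'])
  filter_upwards [h1, h1', h3] with t ht ht' heq
  exact e.injOn ht ht' heq

/-- A group with leading field `X` moves points along the flow of `X`, with a time which does not
depend on the point. -/
lemma HasLeadingField.exists_eq_flow (h : HasLeadingField j X D Ψ) (hG : FormsLocalGroup D Ψ)
    {p₀ : M} (hp₀ : X p₀ ≠ 0) {r : ℕ∞} {D' : Set (ℝ × M)} {Φ : ℝ → M → M}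
    (hΦ : IsFlow r X D' Φ) :
    ∃ F : ℝ → ℝ, Tendsto F (𝓝 0) (𝓝 0) ∧ ∀ p, ∀ᶠ t in 𝓝 (0 : ℝ), Ψ t p = Φ (F t) p := by
  have hX₀ : chartVec X p₀ p₀ ≠ 0 := by rw [chartVec_self]; exact hp₀
  obtain ⟨ℓ, hℓ⟩ : ∃ ℓ : E →L[ℝ] ℝ, 0 < ℓ (chartVec X p₀ p₀) := by
    obtain ⟨ℓ, -, hℓ⟩ := exists_dual_vector ℝ (chartVec X p₀ p₀) (norm_ne_zero_iff.2 hX₀)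
    refine ⟨ℓ, ?_⟩
    rw [hℓ]
    exact norm_pos_iff.2 hX₀
  have hj := h.even_of_formsLocalGroup hG hℓ
  have hvec : ∀ p, ∀ᶠ t in 𝓝 (0 : ℝ), ContinuousAt (fun t => chartVec X p (Ψ t p)) t := by
    intro p
    have hsrc := (h.tendsto_left p).eventually (extChartAt_source_mem_nhds (I := 𝓘(ℝ, E)) p)
    have h1 : ContDiffAt ℝ 1 (fun t => chartVec X p ((extChartAt 𝓘(ℝ, E) p).symm
        (extChartAt 𝓘(ℝ, E) p (Ψ t p)))) 0 := by
      refine ContDiffAt.comp (0 : ℝ) (g := fun y => chartVec X p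
        ((extChartAt 𝓘(ℝ, E) p).symm y)) ?_ (h.contDiffAt p)
      rw [h.map_zero]
      exact contDiffAt_chartVec h.contMDiff p
    have h2 : (fun t => chartVec X p ((extChartAt 𝓘(ℝ, E) p).symm
        (extChartAt 𝓘(ℝ, E) p (Ψ t p)))) =ᶠ[𝓝 0] fun t => chartVec X p (Ψ t p) := by
      filter_upwards [hsrc] with t ht
      rw [(extChartAt 𝓘(ℝ, E) p).left_inv ht]
    filter_upwards [(h1.congr_of_eventuallyEq h2.symm).eventually (by simp)] with t ht
    exact ht.continuousAt
  have hder : ∀ p, ∀ᶠ t in 𝓝 (0 : ℝ),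
      ContinuousAt (deriv fun t => extChartAt 𝓘(ℝ, E) p (Ψ t p)) t := by
    intro p
    filter_upwards [(h.contDiffAt p).eventually (by simp)] with t ht
    have h1 := (ht.fderiv_right (m := 0) (by simp)).continuousAt.clm_apply
      (continuousAt_const (y := (1 : ℝ)))
    simpa only [fderiv_apply_one_eq_deriv] using h1
  have hden : ∀ᶠ t in 𝓝 (0 : ℝ), 0 < ℓ (chartVec X p₀ (Ψ t p₀)) := by
    have h1 : ContinuousAt (fun t => ℓ (chartVec X p₀ (Ψ t p₀))) 0 :=
      ℓ.continuous.continuousAt.comp (hvec p₀).self_of_nhds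
    exact h1.eventually (lt_mem_nhds (by simpa only [h.map_zero] using hℓ))
  -- This is the reciprocal of the factor in `eventually_deriv_eq`; its denominator stays positive
  -- at `t = 0`, where the velocity may vanish.
  set f : ℝ → ℝ := fun t => ℓ (deriv (fun t => extChartAt 𝓘(ℝ, E) p₀ (Ψ t p₀)) t) /
    ℓ (chartVec X p₀ (Ψ t p₀)) with hfdef
  have hf : ∀ᶠ t in 𝓝 (0 : ℝ), ContinuousAt f t := by
    filter_upwards [hvec p₀, hder p₀, hden] with t h1 h2 h3
    exact (ℓ.continuous.continuousAt.comp h2).div (ℓ.continuous.continuousAt.comp h1) h3.ne'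
  have hvel : ∀ p, ∀ᶠ t in 𝓝 (0 : ℝ), HasDerivAt (fun t => extChartAt 𝓘(ℝ, E) p (Ψ t p))
      (f t • chartVec X p (Ψ t p)) t := by
    intro p
    have h1 : ∀ᶠ t in 𝓝 (0 : ℝ), t ≠ 0 → deriv (fun t => extChartAt 𝓘(ℝ, E) p (Ψ t p)) t =
        f t • chartVec X p (Ψ t p) := by
      filter_upwards [h.eventually_deriv_eq hG hℓ p, hden, h.eventually_deriv_pos hj hℓ]
        with t ht h2 h3 h0
      rw [ht h0, smul_smul, hfdef]
      have h4 := (h3 h0).ne'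
      have h5 := h2.ne'
      rw [div_mul_div_cancel₀ h5, div_self h4, one_smul]
    -- The excluded time `t = 0` is recovered by continuity of both sides.
    have h2 : deriv (fun t => extChartAt 𝓘(ℝ, E) p (Ψ t p)) 0 = f 0 • chartVec X p (Ψ 0 p) := by
      have h3 : Tendsto (deriv fun t => extChartAt 𝓘(ℝ, E) p (Ψ t p)) (𝓝[≠] 0)
        (𝓝 (deriv (fun t => extChartAt 𝓘(ℝ, E) p (Ψ t p)) 0)) :=
        (hder p).self_of_nhds.tendsto.mono_left nhdsWithin_le_nhds
      have h4 : Tendsto (fun t => f t • chartVec X p (Ψ t p)) (𝓝[≠] 0)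
        (𝓝 (f 0 • chartVec X p (Ψ 0 p))) :=
        (hf.self_of_nhds.smul (hvec p).self_of_nhds).tendsto.mono_left nhdsWithin_le_nhds
      refine tendsto_nhds_unique h3 (h4.congr' ?_)
      filter_upwards [nhdsWithin_le_nhds h1, self_mem_nhdsWithin] with t ht ht0
      exact (ht ht0).symm
    filter_upwards [h1, h.eventually_hasDerivAt p] with t ht hd
    by_cases h0 : t = 0
    · subst h0
      rwa [h2] at hd
    · rwa [ht h0] at hd
  obtain ⟨F, hF0, hFd⟩ := exists_eventually_hasDerivAt hf
  have hFc : ContinuousAt F 0 := hFd.self_of_nhds.continuousAt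
  have hFt : Tendsto F (𝓝 0) (𝓝 0) := by simpa [ContinuousAt, hF0] using hFc
  refine ⟨F, hFt, fun p => ?_⟩
  have hpair : Tendsto (fun t => (F t, p)) (𝓝 0) (𝓝 (0, p)) := hFt.prodMk_nhds tendsto_const_nhds
  have hc : ContinuousAt (fun t => Φ (F t) p) 0 := by
    have h1 := (hΦ.continuousAt (hΦ.zero_mem p)).tendsto.comp hpair
    simpa [ContinuousAt, hF0, Function.comp_def] using h1
  refine eventuallyEq_of_hasDerivAt_smul h.contMDiff hf.self_of_nhds (h.map_zero p)
    (by rw [hF0, hΦ.map_zero]) (by simpa [ContinuousAt, h.map_zero] using h.tendsto_left p) hc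
    (hvel p) ?_
  have hsrc : ∀ᶠ t in 𝓝 (0 : ℝ), Φ (F t) p ∈ (extChartAt 𝓘(ℝ, E) p).source := by
    refine hc.eventually ?_
    simp only [hF0, hΦ.map_zero]
    exact extChartAt_source_mem_nhds (I := 𝓘(ℝ, E)) p
  filter_upwards [hsrc, hFd, hpair.eventually (hΦ.isOpen.mem_nhds (hΦ.zero_mem p))]
    with t h1 h2 h3
  exact (hasDerivAt_extChartAt_comp (hΦ.hasMFDerivAt h3) h1).scomp t h2

lemma IsFlow.hasStrictDerivAt_chart {r : ℕ∞} {Φ : ℝ → M → M} (hΦ : IsFlow r X D Φ) (hr : 1 ≤ r)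
    (p : M) : HasStrictDerivAt (fun t => extChartAt 𝓘(ℝ, E) p (Φ t p)) (chartVec X p p) 0 := by
  have h1 := hΦ.hasStrictFDerivAt_chart hr (mem_extChartAt_source (I := 𝓘(ℝ, E)) p)
  have h2 := HasStrictFDerivAt.comp_hasStrictDerivAt (0 : ℝ) h1
    ((hasStrictDerivAt_id (0 : ℝ)).prodMk
      (hasStrictDerivAt_const (0 : ℝ) (extChartAt 𝓘(ℝ, E) p p)))
  simpa [Function.comp_def] using h2

/-- Along a curve `c` of nonzero velocity, parameter differences are bounded by differences of
values. -/
lemma HasStrictDerivAt.isBigO_sub_of_ne_zero {c : ℝ → E} {c' : E} (hc : HasStrictDerivAt c c' 0)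
    (hc' : c' ≠ 0) {F G : ℝ → ℝ} {l : Filter ℝ} (hF : Tendsto F l (𝓝 0))
    (hG : Tendsto G l (𝓝 0)) :
    (fun t => F t - G t) =O[l] fun t => c (F t) - c (G t) := by
  have h1 := hc.hasStrictFDerivAt.isLittleO.comp_tendsto (hF.prodMk_nhds hG)
  have h2 : (fun t => F t - G t) =O[l] fun t => (F t - G t) • c' := by
    refine IsBigO.of_bound ‖c'‖⁻¹ (Eventually.of_forall fun t => ?_)
    rw [norm_smul, mul_comm ‖F t - G t‖, ← mul_assoc, inv_mul_cancel₀ (norm_ne_zero_iff.2 hc'),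
      one_mul]
  refine h2.trans ((h1.trans_isBigO h2).right_isBigO_add.congr_right fun t => ?_)
  simp

end GroupFlow

/-! ### Proportionality of the generators of a group -/

section KnightGroups

open Set Filter Asymptotics

variable {E : Type*} [NormedAddCommGroup E] [NormedSpace ℝ E]
  {M : Type*} [TopologicalSpace M] [ChartedSpace E M] [IsManifold 𝓘(ℝ, E) 1 M]
  {r : ℕ∞} {k : ℕ} {ξ : ℕ → (p : M) → TangentSpace 𝓘(ℝ, E) p}
  {Dom : ℕ → Set (ℝ × M)} {φ : ℕ → ℝ → M → M} {D : Set (ℝ × M)} {Ψ : ℝ → M → M}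

/-- If the first `n` generators are multiples of `X` and the whole knight composition moves points
along the flow of `X`, then the next generator is a multiple of `X`. -/
lemma exists_smul_eq_of_knight_eq_flow (hr : 1 ≤ r)
    (hφ : ∀ l, 1 ≤ l → l ≤ k → IsFlow r (ξ l) (Dom l) (φ l)) {n : ℕ} (hn : n + 1 ≤ k)
    {X : (p : M) → TangentSpace 𝓘(ℝ, E) p} {p₀ : M} (hp₀ : X p₀ ≠ 0) {D' : Set (ℝ × M)}
    {Φ : ℝ → M → M} (hΦ : IsFlow r X D' Φ) {F G : ℝ → ℝ} (hF : Tendsto F (𝓝 0) (𝓝 0))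
    (hG : Tendsto G (𝓝 0) (𝓝 0)) (hFk : ∀ p, ∀ᶠ t in 𝓝 (0 : ℝ), knight φ k t p = Φ (F t) p)
    (hGn : ∀ p, ∀ᶠ t in 𝓝 (0 : ℝ), knight φ n t p = Φ (G t) p) :
    ∃ a : ℝ, ∀ p, ξ (n + 1) p = a • X p := by
  have hfac : (Nat.factorial (n + 1) : ℝ) ≠ 0 := by positivity
  have hexp : ∀ p, (fun t => extChartAt 𝓘(ℝ, E) p (Φ (F t) p) -
      extChartAt 𝓘(ℝ, E) p (Φ (G t) p) -
      (t ^ (n + 1) / (Nat.factorial (n + 1) : ℝ)) • chartVec (ξ (n + 1)) p p) =o[𝓝 0]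
      fun t => t ^ (n + 1) := by
    intro p
    have h1 := (isLittleO_knight hr hφ hn le_rfl
      (mem_extChartAt_source (I := 𝓘(ℝ, E)) p)).comp_tendsto
      ((Continuous.prodMk_left p).tendsto' (0 : ℝ) (0, p) rfl)
    refine h1.congr' ?_ EventuallyEq.rfl
    filter_upwards [hFk p, hGn p] with t h2 h3
    simp only [Function.comp, h2, h3]
  have hX₀ : chartVec X p₀ p₀ ≠ 0 := by rw [chartVec_self]; exact hp₀
  -- The point `p₀`, where `X` does not vanish, bounds the time difference; the bound then serves at
  -- every `p`.
  have hO : (fun t => F t - G t) =O[𝓝 0] fun t => t ^ (n + 1) := by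
    refine ((hΦ.hasStrictDerivAt_chart hr p₀).isBigO_sub_of_ne_zero hX₀ hF hG).trans ?_
    have h1 : (fun t : ℝ => (t ^ (n + 1) / (Nat.factorial (n + 1) : ℝ)) •
        chartVec (ξ (n + 1)) p₀ p₀) =O[𝓝 0] fun t => t ^ (n + 1) :=
      IsBigO.of_bound (‖(Nat.factorial (n + 1) : ℝ)⁻¹‖ * ‖chartVec (ξ (n + 1)) p₀ p₀‖)
        (Eventually.of_forall fun x => le_of_eq (by
          rw [norm_smul, div_eq_mul_inv, norm_mul]; ring))
    exact ((hexp p₀).isBigO.add h1).congr_left fun t => sub_add_cancel _ _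
  set β : ℝ → ℝ := fun t => (Nat.factorial (n + 1) : ℝ) * (t ^ (n + 1))⁻¹ * (F t - G t) with hβ
  have hlim : ∀ p, Tendsto (fun t => β t • chartVec X p p) (𝓝[≠] 0)
      (𝓝 (chartVec (ξ (n + 1)) p p)) := by
    intro p
    have h1 := ((hΦ.hasStrictDerivAt_chart hr p).hasStrictFDerivAt.isLittleO.comp_tendsto
      (hF.prodMk_nhds hG)).trans_isBigO hO
    have h2 := (hexp p).sub h1
    have h3 := ((h2.mono (nhdsWithin_le_nhds (s := {0}ᶜ))).tendsto_inv_smul_nhds_zero).const_smul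
      (Nat.factorial (n + 1) : ℝ) |>.add_const (chartVec (ξ (n + 1)) p p)
    rw [smul_zero, zero_add] at h3
    refine h3.congr' ?_
    filter_upwards [self_mem_nhdsWithin] with t ht
    have ht : t ≠ 0 := ht
    simp only [Function.comp, ContinuousLinearMap.toSpanSingleton_apply]
    have h4 : ∀ a b c d : E, a - b - c - (a - b - d) = d - c := fun a b c d => by abel
    rw [h4, smul_sub, smul_sub, smul_smul, smul_smul, smul_smul, smul_smul,
      show (Nat.factorial (n + 1) : ℝ) * (t ^ (n + 1))⁻¹ *
        (t ^ (n + 1) / (Nat.factorial (n + 1) : ℝ)) = 1 by field_simp, one_smul, sub_add_cancel]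
  obtain ⟨ℓ, -, hℓ⟩ := exists_dual_vector ℝ (chartVec X p₀ p₀) (norm_ne_zero_iff.2 hX₀)
  have hℓ0 : ℓ (chartVec X p₀ p₀) ≠ 0 := by
    rw [hℓ]
    exact_mod_cast norm_ne_zero_iff.2 hX₀
  -- The scalar `β` does not involve `p`, so its limit, read off at `p₀`, is the coefficient
  -- everywhere.
  have hβlim : Tendsto β (𝓝[≠] 0)
      (𝓝 (ℓ (chartVec (ξ (n + 1)) p₀ p₀) / ℓ (chartVec X p₀ p₀))) := by
    refine (((ℓ.continuous.tendsto _).comp (hlim p₀)).div_const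
      (ℓ (chartVec X p₀ p₀))).congr fun t => ?_
    simp [hℓ0]
  refine ⟨ℓ (chartVec (ξ (n + 1)) p₀ p₀) / ℓ (chartVec X p₀ p₀), fun p => ?_⟩
  have h1 := tendsto_nhds_unique (hlim p) (hβlim.smul_const (chartVec X p p))
  rw [chartVec_self, chartVec_self (v := X) (p := p)] at h1
  exact h1

variable [T2Space M]

/-- All the conditions are local at `t = 0`, and `Ψ` agrees with the knight composition near `{0} ×
M`. -/
lemma hasLeadingField_of_eq_knight (hr : 1 ≤ r)
    (hφ : ∀ l, 1 ≤ l → l ≤ k → IsFlow r (ξ l) (Dom l) (φ l)) (hDo : IsOpen D)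
    (hD0 : ∀ p, ((0 : ℝ), p) ∈ D) (hΨ : ∀ t p, (t, p) ∈ D → Ψ t p = knight φ k t p) {j : ℕ}
    (hj : j + 1 ≤ k) (h0 : ∀ l, 1 ≤ l → l ≤ j → ∀ p, ξ l p = 0) :
    HasLeadingField j (ξ (j + 1)) D Ψ := by
  have hev : ∀ p, (fun x : ℝ × M => Ψ x.1 x.2) =ᶠ[𝓝 (0, p)] fun x => knight φ k x.1 x.2 :=
    fun p => eventually_of_mem (hDo.mem_nhds (hD0 p)) fun x hx => hΨ x.1 x.2 hx
  have hevl : ∀ p, (fun t => Ψ t p) =ᶠ[𝓝 0] fun t => knight φ k t p := fun p =>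
    (Continuous.prodMk_left p).continuousAt.eventually (hev p)
  have hevc : ∀ p, (fun t => extChartAt 𝓘(ℝ, E) p (Ψ t p)) =ᶠ[𝓝 0]
      fun t => extChartAt 𝓘(ℝ, E) p (knight φ k t p) := fun p =>
    (hevl p).fun_comp (extChartAt 𝓘(ℝ, E) p)
  refine ⟨(hφ _ (by omega) hj).field_contMDiff_one hr, hDo, hD0, fun p => ?_, fun p => ?_,
    fun p q hq => ?_, fun p => ?_, fun p => ?_⟩
  · rw [hΨ 0 p (hD0 p), knight_zero_left hφ le_rfl]
  · exact (tendsto_knight hφ le_rfl p).congr' (hev p).symm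
  · refine (isLittleO_knight_of_eq_zero hr hφ hj le_rfl h0 hq).congr' ?_ EventuallyEq.rfl
    filter_upwards [hev q] with x hx
    rw [hx]
  · exact (contDiffAt_chart_knight hr hφ le_rfl p).congr_of_eventuallyEq (hevc p)
  · refine (isLittleO_deriv_knight hr hφ hj le_rfl h0 p).congr' ?_ EventuallyEq.rfl
    filter_upwards [(hevc p).eventuallyEq_nhds] with t ht
    rw [ht.deriv_eq]

/-- The generators of a group of knight diffeomorphisms are multiples of the first nonzero one. -/
lemma exists_smul_eq_of_formsLocalGroup (hr : 1 ≤ r) (hΨ : IsKnightFamily r k ξ D Ψ)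
    (hG : FormsLocalGroup D Ψ) {j : ℕ} (hj : j + 1 ≤ k)
    (h0 : ∀ l, 1 ≤ l → l ≤ j → ∀ p, ξ l p = 0) {p₀ : M} (hp₀ : ξ (j + 1) p₀ ≠ 0) :
    ∃ α : ℕ → ℝ, (∀ l, 1 ≤ l → l ≤ k → ∀ p, ξ l p = α l • ξ (j + 1) p) ∧
      ∃ U ∈ 𝓝 (0 : ℝ), InjOn (reparam k α) U := by
  obtain ⟨hDo, hD0, Dom, φ, hφ, hsub, heq⟩ := hΨ
  have hL := hasLeadingField_of_eq_knight hr hφ hDo hD0 heq hj h0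
  obtain ⟨D', Φ, hΦ, hmax⟩ := (hφ (j + 1) (by omega) hj).exists_maximal hr
  obtain ⟨F, hF, hFΨ⟩ := hL.exists_eq_flow hG hp₀ hΦ
  have hFk : ∀ p, ∀ᶠ t in 𝓝 (0 : ℝ), knight φ k t p = Φ (F t) p := by
    intro p
    filter_upwards [hFΨ p, hL.eventually_mem p] with t h1 h2
    rw [← h1, heq t p h2]
  have hknight : ∀ n ≤ k, ∀ α : ℕ → ℝ,
      (∀ l, 1 ≤ l → l ≤ n → ∀ p, ξ l p = α l • ξ (j + 1) p) →
      ∀ p, ∀ᶠ t in 𝓝 (0 : ℝ), knight φ n t p = Φ (reparam n α t) p := by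
    intro n hn α hα p
    filter_upwards [(Continuous.prodMk_left p).continuousAt.eventually
      (knightDomain_mem_nhds hφ hn p)] with t ht
    exact (hmax _ _ _ (flowsTo_knight (hΦ.field_contMDiff_one hr) hΦ.flowsTo_zero hr
      (fun l h1 h2 => hφ l h1 (h2.trans hn)) hα ht)).2.symm
  have hind : ∀ n, j + 1 ≤ n → n ≤ k → ∃ α : ℕ → ℝ,
      ∀ l, 1 ≤ l → l ≤ n → ∀ p, ξ l p = α l • ξ (j + 1) p := by
    intro n hjn
    induction n, hjn using Nat.le_induction with
    | base =>
      refine fun _ => ⟨fun l => if l = j + 1 then 1 else 0, fun l h1 h2 p => ?_⟩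
      by_cases hl : l = j + 1
      · subst hl; simp
      · simp [hl, h0 l h1 (by omega) p]
    | succ n hjn ih =>
      intro hn
      obtain ⟨α, hα⟩ := ih (by omega)
      obtain ⟨a, ha⟩ := exists_smul_eq_of_knight_eq_flow hr hφ hn hp₀ hΦ hF
        ((continuous_reparam n α).tendsto' 0 0 (reparam_zero_right n α)) hFk
        (hknight n (by omega) α hα)
      refine ⟨Function.update α (n + 1) a, fun l h1 h2 p => ?_⟩
      by_cases hl : l = n + 1
      · subst hl; simpa using ha p
      · rw [Function.update_of_ne hl]
        exact hα l h1 (by omega) p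
  obtain ⟨α, hα⟩ := hind k hj le_rfl
  refine ⟨α, hα, ?_⟩
  have hX₀ : chartVec (ξ (j + 1)) p₀ p₀ ≠ 0 := by rw [chartVec_self]; exact hp₀
  obtain ⟨ℓ, -, hℓ⟩ := exists_dual_vector ℝ (chartVec (ξ (j + 1)) p₀ p₀)
    (norm_ne_zero_iff.2 hX₀)
  have hℓ0 : 0 < ℓ (chartVec (ξ (j + 1)) p₀ p₀) := by
    rw [hℓ]
    exact norm_pos_iff.2 hX₀
  obtain ⟨ρ, hρ, hmono⟩ := hL.exists_strictMonoOn (hL.even_of_formsLocalGroup hG hℓ0) hℓ0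
  obtain ⟨V, hV, hVeq⟩ := ((hknight k le_rfl α hα p₀).and (hL.eventually_mem p₀)).exists_mem
  -- Equal values of `f` give equal points `Ψ t p₀`, hence equal parameters by strict monotonicity
  -- of `ℓ` along this orbit.
  refine ⟨V ∩ Ioo (-ρ) ρ, inter_mem hV (Ioo_mem_nhds (by linarith) hρ), ?_⟩
  rintro s ⟨hsV, hs⟩ t ⟨htV, ht⟩ hst
  refine (hmono ρ le_rfl).injOn hs ht ?_
  have h1 := hVeq s hsV
  have h2 := hVeq t htV
  simp only [heq s p₀ h1.2, heq t p₀ h2.2, h1.1, h2.1, hst]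

end KnightGroups

/-! ### Assembly of the three statements -/

theorem theorem3
    {E : Type*} [NormedAddCommGroup E] [NormedSpace ℝ E] [FiniteDimensional ℝ E]
    {M : Type*} [TopologicalSpace M] [T2Space M] [ChartedSpace E M] [IsManifold 𝓘(ℝ, E) ∞ M]
    (r : ℕ∞) (hr : 1 ≤ r) (k : ℕ) (hk : 1 ≤ k)
    (ξ : ℕ → (p : M) → TangentSpace 𝓘(ℝ, E) p) (D : Set (ℝ × M)) (Ψ : ℝ → M → M)
    (hΨ : IsKnightFamily r k ξ D Ψ) :
    (FormsLocalGroup D Ψ ↔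
      ∃ (η : (p : M) → TangentSpace 𝓘(ℝ, E) p) (α : ℕ → ℝ),
        ContMDiff 𝓘(ℝ, E) (𝓘(ℝ, E)).tangent r
          (fun p => (⟨p, η p⟩ : TangentBundle 𝓘(ℝ, E) M)) ∧
        (∀ l, 1 ≤ l → l ≤ k → ∀ p, ξ l p = α l • η p) ∧
        ∃ U ∈ 𝓝 (0 : ℝ), Set.InjOn (reparam k α) U) ∧
    ((∃ p, ξ 1 p ≠ 0) →
      (FormsLocalGroup D Ψ ↔
        ∃ (η : (p : M) → TangentSpace 𝓘(ℝ, E) p) (α : ℕ → ℝ),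
          ContMDiff 𝓘(ℝ, E) (𝓘(ℝ, E)).tangent r
            (fun p => (⟨p, η p⟩ : TangentBundle 𝓘(ℝ, E) M)) ∧
          ∀ l, 1 ≤ l → l ≤ k → ∀ p, ξ l p = α l • η p)) ∧
    (∀ (η : (p : M) → TangentSpace 𝓘(ℝ, E) p) (α : ℕ → ℝ),
      (∀ l, 1 ≤ l → l ≤ k → ∀ p, ξ l p = α l • η p) →
      (∃ l, 1 ≤ l ∧ l ≤ k ∧ α l ≠ 0) →
      ∃ (D' : Set (ℝ × M)) (φ : ℝ → M → M), IsFlow r η D' φ ∧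
        ∀ t p, (t, p) ∈ D → (reparam k α t, p) ∈ D' ∧ Ψ t p = φ (reparam k α t) p) := by
  have hforward : FormsLocalGroup D Ψ →
      ∃ (η : (p : M) → TangentSpace 𝓘(ℝ, E) p) (α : ℕ → ℝ),
        ContMDiff 𝓘(ℝ, E) (𝓘(ℝ, E)).tangent r
          (fun p => (⟨p, η p⟩ : TangentBundle 𝓘(ℝ, E) M)) ∧
        (∀ l, 1 ≤ l → l ≤ k → ∀ p, ξ l p = α l • η p) ∧
        ∃ U ∈ 𝓝 (0 : ℝ), Set.InjOn (reparam k α) U := by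
    classical
    intro hG
    have hsmooth : ∀ l, 1 ≤ l → l ≤ k → ContMDiff 𝓘(ℝ, E) (𝓘(ℝ, E)).tangent r
        (fun p => (⟨p, ξ l p⟩ : TangentBundle 𝓘(ℝ, E) M)) := by
      obtain ⟨-, -, Dom, φ, hφ, -⟩ := hΨ
      exact fun l h1 h2 => (hφ l h1 h2).field_contMDiff
    by_cases hex : ∃ j, j + 1 ≤ k ∧ ∃ p, ξ (j + 1) p ≠ 0
    · obtain ⟨hj, p₀, hp₀⟩ := Nat.find_spec hex
      obtain ⟨α, hα, hinj⟩ := exists_smul_eq_of_formsLocalGroup hr hΨ hG hj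
        (fun l h1 h2 p => by
          have h3 := Nat.find_min hex (m := l - 1) (by omega)
          push Not at h3
          have h4 := h3 (by omega) p
          rwa [show l - 1 + 1 = l by omega] at h4) hp₀
      exact ⟨_, α, hsmooth _ (by omega) hj, hα, hinj⟩
    · push Not at hex
      have h0 : ∀ l, 1 ≤ l → l ≤ k → ∀ p, ξ l p = 0 := fun l h1 h2 p => by
        have h3 := hex (l - 1) (by omega) p
        rwa [show l - 1 + 1 = l by omega] at h3
      -- When all generators vanish, the zero field serves with `f(t) = t`, which keeps `f`
      -- injective.
      refine ⟨ξ 1, fun l => if l = 1 then 1 else 0, hsmooth 1 le_rfl hk, fun l h1 h2 p => ?_,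
        exists_injOn_reparam hk (by simp)⟩
      rw [h0 l h1 h2, h0 1 le_rfl hk]
      exact (smul_zero _).symm
  refine ⟨⟨hforward, ?_⟩, fun hne => ⟨fun hG => ?_, ?_⟩, fun η α hξ hα => ?_⟩
  · rintro ⟨η, α, -, hξ, hinj⟩
    exact hΨ.formsLocalGroup hr hξ hinj
  · obtain ⟨η, α, hη, hξ, -⟩ := hforward hG
    exact ⟨η, α, hη, hξ⟩
  · rintro ⟨η, α, -, hξ⟩
    refine hΨ.formsLocalGroup hr hξ (exists_injOn_reparam hk fun h1 => ?_)
    obtain ⟨p, hp⟩ := hne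
    apply hp
    rw [hξ 1 le_rfl hk, h1]
    exact zero_smul ℝ _
  · obtain ⟨D', φ, hφ, hmax, hfl⟩ := hΨ.exists_maximal_flow hr hξ hα
    exact ⟨D', φ, hφ, fun t p htp =>
      ⟨(hmax _ _ _ (hfl t p htp)).1, (hmax _ _ _ (hfl t p htp)).2.symm⟩⟩
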